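/- **Setting.** Let $\phi(\cdot;\mu,v)$ be the density of $N(\mu,v)$. Parameters are $\psi=(\beta,A)\in\mathbb R^p\times(0,\infty)$ with $p\ge 1$. For an observation $(y,x,D)\in\mathbb R\times\mathbb R^p\times(0,\infty)$ and $\gamma\ge 0$ put $$w_\gamma(y,x,D;\psi)=\phi(y;x^\top\beta,A+D)^{\gamma}\{2\pi(A+D)\}^{\gamma^2/(2(1+\gamma))},$$ $$\mathcal D_\gamma(y,x,D;\psi)=\gamma^{-1}w_\gamma(y,x,D;\psi)\ (\gamma>0),\qquad \mathcal D_0(y,x,D;\psi)=\log\phi(y;x^\top\beta,A+D),$$ $$v_\gamma(y,x,D;\psi)=w_\gamma(y,x,D;\psi)\,\frac{D^2}{(A+D)^2}\left\{\gamma(y-x^\top\beta)^2-(A+D)\right\}.$$ Let $\nu$ be a probability law of $(x,D)$ on $\mathbb R^p\times\mathbb R$, let $\Psi\subset\mathbb R^p\times(0,\infty)$ be compact, $\psi_*=(\beta_*,A_*)\in\Psi$, $\omega\in(0,1/2)$, and let $\Gamma$ be a finite set with $\{0,1\}\subseteq\Gamma\subseteq[0,1]$. Let $$Q(\gamma;\psi)=E_{\psi_*}[v_\gamma(y,x,D;\psi)],\qquad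 (x,D)\sim\nu,\quad y\mid x,D\sim N(x^\top\beta_*,A_*+D).$$ For a probability density $\delta$ on $\mathbb R$, the contaminated model is: $(x_i,D_i)\sim\nu$; $\theta_i$ given $(x_i,D_i)$ has density $(1-\omega)\phi(\theta;x_i^\top\beta_*,A_*)+\omega\delta(\theta)$; $y_i\mid\theta_i,x_i,D_i\sim N(\theta_i,D_i)$; and the triples $(y_i,x_i,D_i)$, $i\ge1$, are independent and identically distributed. Let $\widehat\psi_m^{(\gamma)}\in\arg\max_{\psi\in\Psi}\sum_{i=1}^m\mathcal D_\gamma(y_i,x_i,D_i;\psi)$, and let $$\gamma_{op}\in\arg\min_{\gamma\in\Gamma}\sum_{i=1}^m\left\{D_i+v_\gamma(y_i,x_i,D_i;\widehat\psi_m^{(\gamma)})\right\}.$$ **Theorem.** Assume: * $0<D_L\le D\le D_U<\infty$ $\nu$-almost surely; * $x\in\mathcal X$ $\nu$-almost surely for a bounded set $\mathcal X\subset\mathbb R^p$; the first coordinate of $x$ equals $1$ almost surely; $E[xx^\top]$ is positive definite; and $E[xx^\top/(a+D)]$ is nonsingular for every $a>0$; * some $\gamma_*\in\Gamma\setminus\{0\}$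 satisfies $Q(0;\psi_*)>(1-\omega)\,Q(\gamma_*;\psi_*)$. Then there is $\rho_0>0$, depending on $\nu,\mathcal X,D_L,D_U,\Psi,\psi_*,\Gamma,\omega,\gamma_*$ but not on $\delta$, such that the following holds for every probability density $\delta$ on $\mathbb R$. Suppose that * $\delta$ has a finite mean $\mu_\delta$ and a finite variance; * $E[(x^\top\beta_*-\mu_\delta)^2\mid D]\ge A_*+D_U$ almost surely; * for $\gamma=\gamma_*$ and with $z=(y,x,D)$ distributed as an observation of the contaminated model: (a) $\psi\mapsto\partial_\psi\mathcal D_\gamma(z;\psi)$ is twice continuously differentiable on $\mathbb R^p\times(0,\infty)$ for every $z\in\mathbb R\times\mathcal X\times[D_L,D_U]$; (b) there is a root $\psi_\dagger\in\Psi$ of $E[\partial_\psi\mathcal D_\gamma(z;\psi)]=0$; (c) $E\|\partial_\psi\mathcal D_\gamma(z;\psi)\|^2<\infty$ for $\psi\in\Psi$; (d) $E[\partial_\psi\partial_{\psi^\top}\mathcal D_\gamma(z;\psi_\dagger)]$ exists and is nonsingular; (e) the second-order derivatives of $\psi\mapsto\partial_\psi\mathcal D_\gamma(z;\psi)$ are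 dominated, in a neighbourhood of $\psi_\dagger$, by a fixed integrable function of $z$; * with $f_{\delta,D}(y)=\int\phi(y;\theta,D)\delta(\theta)\,d\theta$, $$\rho=\max_{k\in\{0,1,2\}}\ \sup_{D\in[D_L,D_U]}\ \sup_{x\in\mathcal X}\int f_{\delta,D}(y)\,\phi(y;x^\top\beta_*,A_*+D)^{\gamma_*}\,|y-x^\top\beta_*|^k\,dy\ \le\ \rho_0 .$$ Then, under the contaminated model, $P(\gamma_{op}>0)\to1$ as $m\to\infty$. -/

import Mathlib

open MeasureTheory ProbabilityTheory Filter Topology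
open scoped ENNReal

set_option maxSynthPendingDepth 3

namespace RobustFayHerriot

noncomputable section

/-- Covariate vectors and regression coefficients: `ℝ^p`. -/
abbrev Cov (p : ℕ) := EuclideanSpace ℝ (Fin p)

/-- Parameters `ψ = (β, A)`, with `β = ψ.1` and `A = ψ.2`. -/
abbrev Param (p : ℕ) := Cov p × ℝ

/-- One observation `(y, x, D)`. -/
abbrev Obs (p : ℕ) := ℝ × Cov p × ℝ

/-- The density `φ(y; μ, v)` of the normal distribution with mean `μ` and variance `v`. -/
def phi (y μ v : ℝ) : ℝ := gaussianPDFReal μ v.toNNReal y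

/-- The weight `w_γ(y) = φ(y; xᵀβ, A + D)^γ c_γ(A)`, where
`c_γ(A) = (2π(A + D))^(γ² / (2(1 + γ)))`. -/
def weight {p : ℕ} (γ y : ℝ) (x : Cov p) (D : ℝ) (ψ : Param p) : ℝ :=
  phi y (inner ℝ x ψ.1) (ψ.2 + D) ^ γ *
    (2 * Real.pi * (ψ.2 + D)) ^ (γ ^ 2 / (2 * (1 + γ)))

/-- The contribution of one observation to the objective function: the `γ`-divergence
likelihood `γ⁻¹ φ^γ c_γ` for `γ ≠ 0`, and the marginal log-likelihood for `γ = 0`. -/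
def gammaLik {p : ℕ} (γ y : ℝ) (x : Cov p) (D : ℝ) (ψ : Param p) : ℝ :=
  if γ = 0 then Real.log (phi y (inner ℝ x ψ.1) (ψ.2 + D))
  else 1 / γ * weight γ y x D ψ

/-- `w_γ(y) D² / (A + D)² {γ (y - xᵀβ)² - (A + D)}`. -/
def varTerm {p : ℕ} (γ y : ℝ) (x : Cov p) (D : ℝ) (ψ : Param p) : ℝ :=
  weight γ y x D ψ * (D ^ 2 / (ψ.2 + D) ^ 2) *
    (γ * (y - inner ℝ x ψ.1) ^ 2 - (ψ.2 + D))

/-- The robust posterior variance `s̃²^(γ)` of one area. -/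
def robustVar {p : ℕ} (γ y : ℝ) (x : Cov p) (D : ℝ) (ψ : Param p) : ℝ :=
  D + varTerm γ y x D ψ

/-- `Q(γ; ψ)`: the expectation of `varTerm γ y x D ψ` when `(x, D) ~ ν` and
`y | x, D ~ N(xᵀβ⋆, A⋆ + D)`, where `ψ⋆ = (β⋆, A⋆)`. -/
def Q {p : ℕ} (ν : Measure (Cov p × ℝ)) (ψstar : Param p) (γ : ℝ) (ψ : Param p) : ℝ :=
  ∫ z, ∫ y, varTerm γ y z.1 z.2 ψ
    ∂(gaussianReal (inner ℝ z.1 ψstar.1) (ψstar.2 + z.2).toNNReal) ∂ν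

/-- `δ` is a probability density on the real line. -/
structure IsProbDensity (δ : ℝ → ℝ) : Prop where
  measurable : Measurable δ
  nonneg : ∀ θ, 0 ≤ δ θ
  lintegral_eq_one : ∫⁻ θ, ENNReal.ofReal (δ θ) = 1

/-- The mean `μ_δ`. -/
def densityMean (δ : ℝ → ℝ) : ℝ := ∫ θ, θ * δ θ

/-- The density `(1 - ω) φ(θ; xᵀβ⋆, A⋆) + ω δ(θ)` of `θ` given the covariate `x`. -/
def contaminatedDensity {p : ℕ} (ω : ℝ) (ψstar : Param p) (δ : ℝ → ℝ) (x : Cov p)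
    (θ : ℝ) : ℝ :=
  (1 - ω) * phi θ (inner ℝ x ψstar.1) ψstar.2 + ω * δ θ

/-- The joint law of `((x, D), (θ, y))` when `(x, D) ~ ν`, `θ | x, D` has the contaminated
density and `y | θ, x, D ~ N(θ, D)`. -/
def jointLaw {p : ℕ} (ν : Measure (Cov p × ℝ)) (ω : ℝ) (ψstar : Param p) (δ : ℝ → ℝ) :
    Measure ((Cov p × ℝ) × (ℝ × ℝ)) :=
  (ν.prod (volume.prod volume)).withDensity fun z =>
    ENNReal.ofReal
      (contaminatedDensity ω ψstar δ z.1.1 z.2.1 * phi z.2.2 z.2.1 z.1.2)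

/-- The law of an observation `(y, x, D)` under the contaminated model. -/
def obsLaw {p : ℕ} (ν : Measure (Cov p × ℝ)) (ω : ℝ) (ψstar : Param p) (δ : ℝ → ℝ) :
    Measure (Obs p) :=
  (jointLaw ν ω ψstar δ).map fun z => (z.2.2, z.1.1, z.1.2)

/-- The marginal density `f_δ(y) = ∫ φ(y; θ, D) δ(θ) dθ`. -/
def margDensity (δ : ℝ → ℝ) (D y : ℝ) : ℝ≥0∞ :=
  ∫⁻ θ, ENNReal.ofReal (phi y θ D * δ θ)

/-- The separability quantity `ρ = ρ(ψ⋆, γ, δ)`. -/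
def rho {p : ℕ} (X : Set (Cov p)) (DL DU : ℝ) (ψstar : Param p) (γ : ℝ) (δ : ℝ → ℝ) :
    ℝ≥0∞ :=
  ⨆ k ∈ ({0, 1, 2} : Finset ℕ), ⨆ D ∈ Set.Icc DL DU, ⨆ x ∈ X,
    ∫⁻ y, margDensity δ D y *
      ENNReal.ofReal (phi y (inner ℝ x ψstar.1) (ψstar.2 + D) ^ γ *
        |y - inner ℝ x ψstar.1| ^ k)

/-- The score `∂_ψ 𝒟_γ(z; ψ)` at `z = (y, x, D)`, as a linear form on the parameter space. -/
def score {p : ℕ} (γ : ℝ) (z : Obs p) (ψ : Param p) : Param p →L[ℝ] ℝ :=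
  fderiv ℝ (gammaLik γ z.1 z.2.1 z.2.2) ψ

/-- The derivative of the score in the parameter (the Hessian of `𝒟_γ(z; ψ)`). -/
def scoreDeriv {p : ℕ} (γ : ℝ) (z : Obs p) (ψ : Param p) : Param p →L[ℝ] Param p →L[ℝ] ℝ :=
  fderiv ℝ (score γ z) ψ

/-- Regularity conditions (a)-(e) on the score at the pseudo-true parameter `ψdag`, where `F`
is the law of an observation. -/
structure ScoreRegularity {p : ℕ} (F : Measure (Obs p)) (X : Set (Cov p)) (DL DU : ℝ)
    (Ψ : Set (Param p)) (γ : ℝ) (ψdag : Param p) : Prop where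
  mem : ψdag ∈ Ψ
  /-- (a) The score is twice continuously differentiable in the parameter. -/
  smooth : ∀ y : ℝ, ∀ x ∈ X, ∀ D ∈ Set.Icc DL DU,
    ContDiffOn ℝ 2 (score γ (y, x, D)) {ψ | 0 < ψ.2}
  /-- (b) `ψdag` is a root of the expected score. -/
  root : Integrable (fun z => score γ z ψdag) F ∧ ∫ z, score γ z ψdag ∂F = 0
  /-- (c) The score is square integrable. -/
  sq_integrable : ∀ ψ ∈ Ψ, Integrable (fun z => ‖score γ z ψ‖ ^ 2) F
  /-- (d) The expected derivative of the score exists and is nonsingular. -/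
  nonsingular : Integrable (fun z => scoreDeriv γ z ψdag) F ∧
    Function.Bijective ⇑(∫ z, scoreDeriv γ z ψdag ∂F)
  /-- (e) The second-order derivatives of the score are dominated near `ψdag`. -/
  dominated : ∃ U ∈ 𝓝 ψdag, ∃ Dbar : Obs p → ℝ, Integrable Dbar F ∧
    ∀ᵐ z ∂F, ∀ ψ ∈ U, ‖fderiv ℝ (scoreDeriv γ z) ψ‖ ≤ Dbar z

/-- `ψhat` maximizes `∑_{i < m} 𝒟_γ(y_i; ψ)` (for `γ = 0`: the marginal log-likelihood)
over the parameter space `Ψ`. -/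
def IsEstimate {p : ℕ} (Ψ : Set (Param p)) (γ : ℝ) (m : ℕ) (y : ℕ → ℝ) (x : ℕ → Cov p)
    (D : ℕ → ℝ) (ψhat : Param p) : Prop :=
  ψhat ∈ Ψ ∧
    IsMaxOn (fun ψ => ∑ i ∈ Finset.range m, gammaLik γ (y i) (x i) (D i) ψ) Ψ ψhat

/-- `γop` minimizes `∑_{i < m} ŝ_i²^(γ)` over `γ ∈ Γ`, where `ŝ_i²^(γ)` is the robust
posterior variance at the estimate `ψhat γ`. -/
def IsSelected {p : ℕ} (Γ : Finset ℝ) (m : ℕ) (y : ℕ → ℝ) (x : ℕ → Cov p)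
    (D : ℕ → ℝ) (ψhat : ℝ → Param p) (γop : ℝ) : Prop :=
  γop ∈ Γ ∧
    IsMinOn (fun γ => ∑ i ∈ Finset.range m, robustVar γ (y i) (x i) (D i) (ψhat γ)) (Γ : Set ℝ) γop

end

end RobustFayHerriot

namespace RobustFayHerriot

/-! ### The normal density -/

/-! The comparison is between the average variance terms at `γstar` and at `0`. Put κ = Q(0; ψ⋆) −
(1 − ω) Q(γ⋆; ψ⋆) > 0; every error below is made small relative to κ.

The law of an observation is the mixture (1 − ω) core + ω contamination (`obsLaw_eq`), where the
core is the Gaussian model at ψ⋆. Smallness of ρ enters only through one consequence: the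
contaminating law gives (1 + y²)⁻¹ a small expectation e, so its mass sits far from the origin
(`exists_rho_bound`). This acts in opposite ways on the two candidates.

For γ⋆ > 0 the objective and the variance term are at most C (1 + y²)⁻¹ uniformly in ψ
(`exists_bound`), so contamination shifts their expectations by at most ωCe. The core objective has
ψ⋆ as unique maximizer (`integral_gammaLik_lt`), and compactness gives a margin η such that
η-near-maximizers have core variance term below its value at ψ⋆ plus a small error (`exists_gap`). A
uniform strong law makes the estimate a near-maximizer, so the average variance term is eventually
at most (1 − ω) Q(γ⋆; ψ⋆) plus a small error (`eventually_average_varTerm_le`). The factor 1 − ω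
appears because outlying observations contribute almost nothing.

For γ = 0 the variance term is −D²/(A + D), which increases with A and ignores y. Contamination far
away makes the average of y² large, and then the marginal likelihood rules out every A below A⋆ − ε
(`exists_gammaLik_zero_gap`, `le_estimate_snd`). Hence the average variance term is eventually at
least Q(0; ψ⋆) minus a small error. No convergence of the maximum likelihood estimate is needed.

So `0` eventually loses to `γstar` almost surely, which gives the limit of the probabilities. -/

theorem phi_eq {v : ℝ} (hv : 0 < v) (y μ : ℝ) :
    phi y μ v = (√(2 * Real.pi * v))⁻¹ * Real.exp (-(y - μ) ^ 2 / (2 * v)) := by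
  simp [phi, gaussianPDFReal, Real.coe_toNNReal v hv.le]

theorem phi_nonneg (y μ v : ℝ) : 0 ≤ phi y μ v := gaussianPDFReal_nonneg _ _ _

theorem phi_pos {v : ℝ} (hv : 0 < v) (y μ : ℝ) : 0 < phi y μ v :=
  gaussianPDFReal_pos _ _ _ (by simpa using hv)

theorem measurable_phi : Measurable fun q : ℝ × ℝ × ℝ => phi q.1 q.2.1 q.2.2 := by
  unfold phi gaussianPDFReal
  fun_prop

@[fun_prop]
theorem _root_.Measurable.phi {α : Type*} [MeasurableSpace α] {f g h : α → ℝ}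
    (hf : Measurable f) (hg : Measurable g) (hh : Measurable h) :
    Measurable fun a => RobustFayHerriot.phi (f a) (g a) (h a) :=
  measurable_phi.comp (hf.prodMk (hg.prodMk hh))

theorem lintegral_phi {v : ℝ} (hv : 0 < v) (μ : ℝ) :
    ∫⁻ y, ENNReal.ofReal (phi y μ v) = 1 :=
  lintegral_gaussianPDFReal_eq_one μ (by simpa using hv)

theorem integral_phi {v : ℝ} (hv : 0 < v) (μ : ℝ) : ∫ y, phi y μ v = 1 :=
  integral_gaussianPDFReal_eq_one μ (by simpa using hv)

/-- Complete the square in θ: prior times likelihood equals marginal times posterior. Integrating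
out θ then leaves only the marginal. -/
theorem phi_mul_phi {v₁ v₂ : ℝ} (h₁ : 0 < v₁) (h₂ : 0 < v₂) (θ a y : ℝ) :
    phi θ a v₁ * phi y θ v₂ =
      phi y a (v₁ + v₂) *
        phi θ ((v₂ * a + v₁ * y) / (v₁ + v₂)) (v₁ * v₂ / (v₁ + v₂)) := by
  have h12 : 0 < v₁ + v₂ := by positivity
  have hπ := Real.pi_pos
  rw [phi_eq h₁, phi_eq h₂, phi_eq h12, phi_eq (by positivity)]
  rw [mul_mul_mul_comm, mul_mul_mul_comm (√(2 * Real.pi * (v₁ + v₂)))⁻¹, ← Real.exp_add,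
    ← Real.exp_add, ← mul_inv, ← mul_inv, ← Real.sqrt_mul (by positivity),
    ← Real.sqrt_mul (by positivity)]
  have h1 : 2 * Real.pi * v₁ * (2 * Real.pi * v₂) =
      2 * Real.pi * (v₁ + v₂) * (2 * Real.pi * (v₁ * v₂ / (v₁ + v₂))) := by field_simp
  have h2 : -(θ - a) ^ 2 / (2 * v₁) + -(y - θ) ^ 2 / (2 * v₂) =
      -(y - a) ^ 2 / (2 * (v₁ + v₂)) +
        -(θ - (v₂ * a + v₁ * y) / (v₁ + v₂)) ^ 2 / (2 * (v₁ * v₂ / (v₁ + v₂))) := by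
    field_simp
    ring
  rw [h1, h2]

theorem lintegral_phi_mul_phi {v₁ v₂ : ℝ} (h₁ : 0 < v₁) (h₂ : 0 < v₂) (a y : ℝ) :
    ∫⁻ θ, ENNReal.ofReal (phi θ a v₁ * phi y θ v₂) =
      ENNReal.ofReal (phi y a (v₁ + v₂)) := by
  simp_rw [phi_mul_phi h₁ h₂, ENNReal.ofReal_mul (phi_nonneg _ _ _)]
  rw [lintegral_const_mul _ (by fun_prop), lintegral_phi (by positivity), mul_one]

theorem integral_phi_mul_phi {v₁ v₂ : ℝ} (h₁ : 0 < v₁) (h₂ : 0 < v₂) (a y : ℝ) :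
    ∫ θ, phi θ a v₁ * phi y θ v₂ = phi y a (v₁ + v₂) := by
  simp_rw [phi_mul_phi h₁ h₂]
  rw [integral_const_mul, integral_phi (by positivity), mul_one]

/-! ### The weights -/

/-- The powers of 2π(A + D) combine as −γ/2 + γ²/(2(1 + γ)) = −γ/(2(1 + γ)). -/
theorem weight_eq {p : ℕ} {γ : ℝ} (hγ : 0 ≤ γ) {D : ℝ} {ψ : Param p} (hV : 0 < ψ.2 + D)
    (y : ℝ) (x : Cov p) :
    weight γ y x D ψ = (2 * Real.pi * (ψ.2 + D)) ^ (-(γ / (2 * (1 + γ)))) *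
      Real.exp (-(γ * (y - inner ℝ x ψ.1) ^ 2 / (2 * (ψ.2 + D)))) := by
  have hπ := Real.pi_pos
  have h2 : 0 < 2 * Real.pi * (ψ.2 + D) := by positivity
  rw [weight, phi_eq hV, Real.mul_rpow (by positivity) (by positivity), ← Real.exp_mul,
    Real.sqrt_eq_rpow, ← Real.rpow_neg h2.le, ← Real.rpow_mul h2.le, mul_right_comm,
    ← Real.rpow_add h2]
  congr 2
  · field_simp
    ring
  · ring

theorem weight_pos {p : ℕ} {γ : ℝ} (hγ : 0 ≤ γ) {D : ℝ} {ψ : Param p} (hV : 0 < ψ.2 + D)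
    (y : ℝ) (x : Cov p) : 0 < weight γ y x D ψ := by
  have hπ := Real.pi_pos
  rw [weight_eq hγ hV]
  positivity

theorem varTerm_zero {p : ℕ} {D : ℝ} {ψ : Param p} (hV : 0 < ψ.2 + D) (y : ℝ) (x : Cov p) :
    varTerm 0 y x D ψ = -(D ^ 2 / (ψ.2 + D)) := by
  simp only [varTerm, weight]
  simp
  field_simp
  ring

/-- With t = γ(y − μ)²/(2V), 1 + y² is at most affine in t. Since eᵗ ≥ 1 + t + t²/2, the quantities
e⁻ᵗ, te⁻ᵗ and t²e⁻ᵗ are at most 1, 1 and 2. The factor 1 + 2t is there to absorb |γ(y − μ)² − V| ≤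
V(1 + 2t). -/
theorem one_add_sq_mul_exp_le {γ V Vu B y μ : ℝ} (hγ : 0 < γ) (hV : 0 < V) (hVu : V ≤ Vu)
    (hμ : |μ| ≤ B) :
    (1 + y ^ 2) * ((1 + 2 * (γ * (y - μ) ^ 2 / (2 * V))) *
      Real.exp (-(γ * (y - μ) ^ 2 / (2 * V)))) ≤ 3 * (1 + 2 * B ^ 2) + 5 * (4 * Vu / γ) := by
  set t := γ * (y - μ) ^ 2 / (2 * V) with ht
  have ht0 : 0 ≤ t := by positivity
  have hB : μ ^ 2 ≤ B ^ 2 := by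
    rw [← sq_abs μ]; exact pow_le_pow_left₀ (abs_nonneg _) hμ 2
  have hsq : (y - μ) ^ 2 = 2 * V * t / γ := by rw [ht]; field_simp
  have hle : (y - μ) ^ 2 ≤ 2 * Vu * t / γ := by rw [hsq]; gcongr
  set b := 4 * Vu / γ with hb
  have hb0 : 0 ≤ b := by have := hV.le.trans hVu; positivity
  have h1 : 1 + y ^ 2 ≤ (1 + 2 * B ^ 2) + b * t := by
    have : b * t = 2 * (2 * Vu * t / γ) := by rw [hb]; ring
    rw [this]
    nlinarith [sq_nonneg (y - 2 * μ)]
  set E := Real.exp (-t) with hE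
  have hE0 : 0 < E := Real.exp_pos _
  have hq : 1 + t + t ^ 2 / 2 ≤ Real.exp t := Real.quadratic_le_exp_of_nonneg ht0
  have hprod : Real.exp t * E = 1 := by rw [hE, ← Real.exp_add]; simp
  have hmain : (1 + t + t ^ 2 / 2) * E ≤ 1 := by
    exact (mul_le_mul_of_nonneg_right hq hE0.le).trans_eq hprod
  have e0 : E ≤ 1 := by nlinarith [mul_nonneg ht0 hE0.le, mul_nonneg (sq_nonneg t) hE0.le]
  have e1 : t * E ≤ 1 := by nlinarith [mul_nonneg (sq_nonneg t) hE0.le]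
  have e2 : t ^ 2 * E ≤ 2 := by nlinarith [mul_nonneg ht0 hE0.le]
  calc (1 + y ^ 2) * ((1 + 2 * t) * E)
      ≤ ((1 + 2 * B ^ 2) + b * t) * ((1 + 2 * t) * E) := by gcongr
    _ = (1 + 2 * B ^ 2) * E + (2 * (1 + 2 * B ^ 2)) * (t * E) + b * (t * E)
        + 2 * b * (t ^ 2 * E) := by ring
    _ ≤ (1 + 2 * B ^ 2) * 1 + (2 * (1 + 2 * B ^ 2)) * 1 + b * 1 + 2 * b * 2 := by gcongr
    _ = _ := by ring

/-- The `γ`-likelihood contributions and the variance terms decay like `(1 + y²)⁻¹`, uniformly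
over bounded parameters. -/
theorem exists_bound {p : ℕ} {γ DL DU Al Au B : ℝ} (hγ : 0 < γ) (hDL : 0 < DL) (hAl : 0 ≤ Al) :
    ∃ C, 0 < C ∧ ∀ (ψ : Param p) (y : ℝ) (x : Cov p) (D : ℝ), D ∈ Set.Icc DL DU →
      ψ.2 ∈ Set.Icc Al Au → |inner ℝ x ψ.1| ≤ B →
      |gammaLik γ y x D ψ| ≤ C * (1 + y ^ 2)⁻¹ ∧ |varTerm γ y x D ψ| ≤ C * (1 + y ^ 2)⁻¹ := by
  have hπ := Real.pi_pos
  set c := (2 * Real.pi * DL) ^ (-(γ / (2 * (1 + γ))))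
  have hc : 0 < c := by positivity
  set K := 3 * (1 + 2 * B ^ 2) + 5 * (4 * (|Au| + |DU|) / γ)
  have hK : 0 < K := by positivity
  have hS : 0 ≤ 1 / γ + (|Au| + |DU|) := by positivity
  refine ⟨(1 / γ + (|Au| + |DU|)) * (c * K), by positivity, fun ψ y x D hD hA hB => ?_⟩
  have hD0 : 0 < D := hDL.trans_le hD.1
  have hA0 : 0 ≤ ψ.2 := hAl.trans hA.1
  have hV : 0 < ψ.2 + D := by positivity
  have hVu : ψ.2 + D ≤ |Au| + |DU| :=
    add_le_add (hA.2.trans (le_abs_self _)) (hD.2.trans (le_abs_self _))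
  have hmain := one_add_sq_mul_exp_le (y := y) hγ hV hVu hB
  have hw := weight_eq hγ.le hV y x
  set t := γ * (y - inner ℝ x ψ.1) ^ 2 / (2 * (ψ.2 + D)) with ht
  have ht0 : 0 ≤ t := by positivity
  have hwle : weight γ y x D ψ ≤ c * Real.exp (-t) := by
    rw [hw]
    gcongr ?_ * _
    apply Real.rpow_le_rpow_of_nonpos (by positivity)
    · have : DL ≤ ψ.2 + D := by linarith [hD.1]
      gcongr
    · have : 0 ≤ γ / (2 * (1 + γ)) := by positivity
      linarith
  have hw0 := weight_pos hγ.le hV y x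
  have hy : 0 < 1 + y ^ 2 := by positivity
  have hwt : weight γ y x D ψ * (1 + 2 * t) ≤ c * K * (1 + y ^ 2)⁻¹ := by
    rw [← div_eq_mul_inv, le_div_iff₀ hy]
    calc weight γ y x D ψ * (1 + 2 * t) * (1 + y ^ 2)
        ≤ c * Real.exp (-t) * (1 + 2 * t) * (1 + y ^ 2) := by gcongr
      _ = c * ((1 + y ^ 2) * ((1 + 2 * t) * Real.exp (-t))) := by ring
      _ ≤ c * K := by gcongr
  have hw1 : weight γ y x D ψ ≤ weight γ y x D ψ * (1 + 2 * t) :=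
    le_mul_of_one_le_right hw0.le (by linarith)
  constructor
  · rw [gammaLik, if_neg hγ.ne', abs_of_pos (by positivity)]
    calc 1 / γ * weight γ y x D ψ ≤ 1 / γ * (c * K * (1 + y ^ 2)⁻¹) := by
          gcongr; exact hw1.trans hwt
      _ ≤ (1 / γ + (|Au| + |DU|)) * (c * K * (1 + y ^ 2)⁻¹) := by
          exact mul_le_mul_of_nonneg_right
            (by linarith [abs_nonneg Au, abs_nonneg DU]) (by positivity)
      _ = _ := by ring
  · rw [varTerm, abs_mul, abs_mul, abs_of_pos hw0, abs_of_nonneg (by positivity)]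
    have h1 : D ^ 2 / (ψ.2 + D) ^ 2 ≤ 1 := by
      rw [div_le_one (by positivity)]; gcongr; linarith
    have h2 : |γ * (y - inner ℝ x ψ.1) ^ 2 - (ψ.2 + D)| ≤ (ψ.2 + D) * (1 + 2 * t) := by
      have : γ * (y - inner ℝ x ψ.1) ^ 2 = (ψ.2 + D) * (2 * t) := by rw [ht]; field_simp
      rw [this, abs_le]
      constructor <;> nlinarith [mul_nonneg hV.le ht0]
    calc weight γ y x D ψ * (D ^ 2 / (ψ.2 + D) ^ 2)
          * |γ * (y - inner ℝ x ψ.1) ^ 2 - (ψ.2 + D)|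
        ≤ weight γ y x D ψ * 1 * ((ψ.2 + D) * (1 + 2 * t)) := by gcongr
      _ = (ψ.2 + D) * (weight γ y x D ψ * (1 + 2 * t)) := by ring
      _ ≤ (|Au| + |DU|) * (c * K * (1 + y ^ 2)⁻¹) := by gcongr
      _ ≤ (1 / γ + (|Au| + |DU|)) * (c * K * (1 + y ^ 2)⁻¹) := by
          have : 0 < 1 / γ := by positivity
          exact mul_le_mul_of_nonneg_right (by linarith) (by positivity)
      _ = _ := by ring

/-! ### The expected weight under a normal model -/

/-- Up to a constant, the weight is a normal density of variance V/γ, so the integral is a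
convolution of two Gaussians, with variance V₀ + V/γ. -/
theorem integral_phi_mul_weight {p : ℕ} {γ : ℝ} (hγ : 0 < γ) {D V₀ : ℝ} {ψ : Param p}
    (hV : 0 < ψ.2 + D) (hV₀ : 0 < V₀) (x : Cov p) (a : ℝ) :
    ∫ y, phi y a V₀ * weight γ y x D ψ =
      (2 * Real.pi * (ψ.2 + D)) ^ (-(γ / (2 * (1 + γ)))) *
        ((√((ψ.2 + D + γ * V₀) / (ψ.2 + D)))⁻¹ *
          Real.exp (-(γ * (inner ℝ x ψ.1 - a) ^ 2 / (2 * (ψ.2 + D + γ * V₀))))) := by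
  have hπ := Real.pi_pos
  set V := ψ.2 + D
  have hw : ∀ y, phi y a V₀ * weight γ y x D ψ =
      ((2 * Real.pi * V) ^ (-(γ / (2 * (1 + γ)))) * √(2 * Real.pi * (V / γ))) *
        (phi y a V₀ * phi (inner ℝ x ψ.1) y (V / γ)) := by
    intro y
    have h0 : √(2 * Real.pi * (V / γ)) ≠ 0 := by positivity
    rw [weight_eq hγ.le hV, phi_eq (v := V / γ) (by positivity)]
    rw [show -(inner ℝ x ψ.1 - y) ^ 2 / (2 * (V / γ)) =
      -(γ * (y - inner ℝ x ψ.1) ^ 2 / (2 * V)) by field_simp; ring]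
    field_simp
    rfl
  simp_rw [hw]
  rw [integral_const_mul, integral_phi_mul_phi hV₀ (by positivity),
    phi_eq (by positivity), mul_assoc, ← mul_assoc (√_) (√_)⁻¹]
  congr 2
  · rw [← Real.sqrt_inv, ← Real.sqrt_inv, ← Real.sqrt_mul (by positivity)]
    congr 1
    field_simp
    ring
  · congr 1
    field_simp
    ring

/-- With r = V₀/V the claim reduces to (1 + γ) r^(γ/(1+γ)) ≤ 1 + γr. This is Bernoulli's inequality
for the exponent γ/(1 + γ) ∈ (0, 1), strict unless r = 1. -/
theorem rpow_mul_inv_sqrt_le {γ V V₀ : ℝ} (hγ : 0 < γ) (hV : 0 < V) (hV₀ : 0 < V₀) :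
    (2 * Real.pi * V) ^ (-(γ / (2 * (1 + γ)))) * (√((V + γ * V₀) / V))⁻¹ ≤
      (2 * Real.pi * V₀) ^ (-(γ / (2 * (1 + γ)))) * (√((V₀ + γ * V₀) / V₀))⁻¹ ∧
    ((2 * Real.pi * V) ^ (-(γ / (2 * (1 + γ)))) * (√((V + γ * V₀) / V))⁻¹ =
      (2 * Real.pi * V₀) ^ (-(γ / (2 * (1 + γ)))) * (√((V₀ + γ * V₀) / V₀))⁻¹ → V = V₀) := by
  have hπ := Real.pi_pos
  set e := γ / (2 * (1 + γ)) with he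
  obtain ⟨r, hr, rfl⟩ : ∃ r, 0 < r ∧ V₀ = V * r := ⟨V₀ / V, by positivity, by field_simp⟩
  have hq : 2 * Real.pi * (V * r) = (2 * Real.pi * V) * r := by ring
  rw [show (V + γ * (V * r)) / V = 1 + γ * r by field_simp,
    show (V * r + γ * (V * r)) / (V * r) = 1 + γ by field_simp, hq,
    Real.mul_rpow (by positivity) hr.le, mul_assoc (_ ^ _) (r ^ _)]
  have hc : 0 < (2 * Real.pi * V) ^ (-e) := by positivity
  have key : r ≠ 1 → (√(1 + γ * r))⁻¹ < r ^ (-e) * (√(1 + γ))⁻¹ := by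
    intro hr1
    have hb : r ^ (γ / (1 + γ)) < 1 + (γ / (1 + γ)) * (r - 1) := by
      have := rpow_one_add_lt_one_add_mul_self (s := r - 1) (p := γ / (1 + γ))
        (by linarith) (sub_ne_zero.2 hr1) (by positivity)
        (by rw [div_lt_one (by positivity)]; linarith)
      simpa using this
    have hre : r ^ e = √(r ^ (γ / (1 + γ))) := by
      rw [Real.sqrt_eq_rpow, ← Real.rpow_mul hr.le, he]
      congr 1
      field_simp
    rw [Real.rpow_neg hr.le, ← mul_inv, hre, ← Real.sqrt_mul (by positivity)]
    have : r ^ (γ / (1 + γ)) * (1 + γ) < 1 + γ * r := by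
      calc r ^ (γ / (1 + γ)) * (1 + γ) < (1 + (γ / (1 + γ)) * (r - 1)) * (1 + γ) := by gcongr
        _ = 1 + γ * r := by field_simp; ring
    gcongr
  rcases eq_or_ne r 1 with rfl | hr1
  · simp
  · have := key hr1
    refine ⟨mul_le_mul_of_nonneg_left this.le hc.le, fun h => ?_⟩
    rw [mul_right_inj' hc.ne'] at h
    exact absurd h this.ne

/-- The expected weight is maximal exactly at the true conditional mean and variance. -/
theorem integral_weight_le {p : ℕ} {γ : ℝ} (hγ : 0 < γ) {D : ℝ} {ψ ψ₀ : Param p}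
    (hV : 0 < ψ.2 + D) (hV₀ : 0 < ψ₀.2 + D) (x : Cov p) :
    ∫ y, phi y (inner ℝ x ψ₀.1) (ψ₀.2 + D) * weight γ y x D ψ ≤
      ∫ y, phi y (inner ℝ x ψ₀.1) (ψ₀.2 + D) * weight γ y x D ψ₀ ∧
    (∫ y, phi y (inner ℝ x ψ₀.1) (ψ₀.2 + D) * weight γ y x D ψ =
      ∫ y, phi y (inner ℝ x ψ₀.1) (ψ₀.2 + D) * weight γ y x D ψ₀ →
      inner ℝ x ψ.1 = (inner ℝ x ψ₀.1 : ℝ) ∧ ψ.2 = ψ₀.2) := by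
  have hπ := Real.pi_pos
  rw [integral_phi_mul_weight hγ hV hV₀, integral_phi_mul_weight hγ hV₀ hV₀]
  obtain ⟨h1, h2⟩ := rpow_mul_inv_sqrt_le hγ hV hV₀
  rw [← mul_assoc, ← mul_assoc]
  set a := (2 * Real.pi * (ψ.2 + D)) ^ (-(γ / (2 * (1 + γ)))) *
    (√((ψ.2 + D + γ * (ψ₀.2 + D)) / (ψ.2 + D)))⁻¹
  set b := (2 * Real.pi * (ψ₀.2 + D)) ^ (-(γ / (2 * (1 + γ)))) *
    (√((ψ₀.2 + D + γ * (ψ₀.2 + D)) / (ψ₀.2 + D)))⁻¹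
  have ha : 0 < a := by positivity
  simp only [sub_self, ne_eq, OfNat.ofNat_ne_zero, not_false_eq_true, zero_pow, mul_zero,
    zero_div, neg_zero, Real.exp_zero, mul_one]
  have ht : 0 ≤ γ * (inner ℝ x ψ.1 - inner ℝ x ψ₀.1) ^ 2 /
      (2 * (ψ.2 + D + γ * (ψ₀.2 + D))) := by positivity
  have hle : a * Real.exp (-(γ * (inner ℝ x ψ.1 - inner ℝ x ψ₀.1) ^ 2 /
      (2 * (ψ.2 + D + γ * (ψ₀.2 + D))))) ≤ a :=
    mul_le_of_le_one_right ha.le (Real.exp_le_one_iff.2 (by linarith))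
  refine ⟨hle.trans h1, fun h => ?_⟩
  -- Equality in a · exp(−t) ≤ a ≤ b forces both equalities: a = b identifies the variance, and
  -- exp(−t) = 1 the mean.
  have hab : a = b := le_antisymm h1 (h ▸ hle)
  refine ⟨?_, by linarith [h2 hab]⟩
  rw [← hab, mul_eq_left₀ ha.ne', Real.exp_eq_one_iff, neg_eq_zero, div_eq_zero_iff] at h
  rcases h with h | h
  · rcases mul_eq_zero.1 h with h | h
    · exact absurd h hγ.ne'
    · exact sub_eq_zero.1 (pow_eq_zero_iff two_ne_zero |>.1 h)
  · exact absurd h (by positivity)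


/-! ### Laws of observations with a conditional density -/

/-- The law of `(y, x, D)` when `(x, D) ~ ν` and `y` has density `g (x, D)` given `(x, D)`. -/
noncomputable def densityLaw {p : ℕ} (ν : Measure (Cov p × ℝ)) (g : Cov p × ℝ → ℝ → ℝ≥0∞) :
    Measure (Obs p) :=
  ((ν.prod volume).withDensity fun q => g q.1 q.2).map fun q => (q.2, q.1.1, q.1.2)

section densityLaw

variable {p : ℕ} {ν : Measure (Cov p × ℝ)} {g : Cov p × ℝ → ℝ → ℝ≥0∞}

theorem lintegral_densityLaw [SFinite ν] (hg : Measurable fun q : (Cov p × ℝ) × ℝ => g q.1 q.2)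
    {f : Obs p → ℝ≥0∞} (hf : Measurable f) :
    ∫⁻ w, f w ∂(densityLaw ν g) = ∫⁻ z, (∫⁻ y, g z y * f (y, z.1, z.2)) ∂ν := by
  rw [densityLaw, lintegral_map hf (by fun_prop),
    lintegral_withDensity_eq_lintegral_mul _ hg (by fun_prop),
    lintegral_prod _ (by fun_prop)]
  rfl

theorem isProbabilityMeasure_densityLaw [IsProbabilityMeasure ν]
    (hg : Measurable fun q : (Cov p × ℝ) × ℝ => g q.1 q.2)
    (h1 : ∀ᵐ z ∂ν, ∫⁻ y, g z y = 1) : IsProbabilityMeasure (densityLaw ν g) := by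
  constructor
  rw [← lintegral_one, lintegral_densityLaw hg measurable_const]
  simp only [mul_one]
  rw [lintegral_congr_ae h1]
  simp

/-- Transfers almost sure statements about (x, D) to the observation. Absolute continuity suffices,
so neither the covariate set nor `g` has to be measurable. -/
theorem quasiMeasurePreserving_snd_densityLaw :
    Measure.QuasiMeasurePreserving Prod.snd (densityLaw ν g) ν := by
  refine ⟨measurable_snd, ?_⟩
  rw [densityLaw, Measure.map_map measurable_snd (by fun_prop)]
  exact ((withDensity_absolutelyContinuous _ _).map measurable_fst).trans
    Measure.quasiMeasurePreserving_fst.absolutelyContinuous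

theorem integral_densityLaw [SFinite ν] {k : Cov p × ℝ → ℝ → ℝ}
    (hk : Measurable fun q : (Cov p × ℝ) × ℝ => k q.1 q.2) (hk0 : ∀ z y, 0 ≤ k z y)
    {f : Obs p → ℝ} (hfm : Measurable f)
    (hf : Integrable f (densityLaw ν fun z y => ENNReal.ofReal (k z y))) :
    Integrable (fun z : Cov p × ℝ => ∫ y, k z y * f (y, z.1, z.2)) ν ∧
    ∫ w, f w ∂(densityLaw ν fun z y => ENNReal.ofReal (k z y)) =
      ∫ z, (∫ y, k z y * f (y, z.1, z.2)) ∂ν := by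
  have hfin : ∀ᵐ q : (Cov p × ℝ) × ℝ ∂(ν.prod volume), ENNReal.ofReal (k q.1 q.2) < ⊤ :=
    Eventually.of_forall fun _ => ENNReal.ofReal_lt_top
  have hm : Measurable fun q : (Cov p × ℝ) × ℝ => ((q.2, q.1.1, q.1.2) : Obs p) := by fun_prop
  rw [densityLaw] at hf
  rw [integrable_map_measure hfm.aestronglyMeasurable hm.aemeasurable,
    integrable_withDensity_iff_integrable_smul' (by fun_prop) hfin] at hf
  simp only [ENNReal.toReal_ofReal (hk0 _ _), smul_eq_mul, Function.comp] at hf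
  refine ⟨hf.integral_prod_left, ?_⟩
  rw [densityLaw, integral_map hm.aemeasurable hfm.aestronglyMeasurable,
    integral_withDensity_eq_integral_toReal_smul (by fun_prop) hfin]
  simp only [ENNReal.toReal_ofReal (hk0 _ _), smul_eq_mul]
  rw [integral_prod _ hf]

end densityLaw

/-! ### The two components of the contaminated model -/

section mixture

variable {p : ℕ} {ν : Measure (Cov p × ℝ)} [IsProbabilityMeasure ν] {DL DU : ℝ}
  {ψ₀ : Param p} {δ : ℝ → ℝ}

/-- The law of an observation under the Gaussian model with parameter `ψ₀`. -/
noncomputable def coreLaw (ν : Measure (Cov p × ℝ)) (ψ₀ : Param p) : Measure (Obs p) :=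
  densityLaw ν fun z y => ENNReal.ofReal (phi y (inner ℝ z.1 ψ₀.1) (ψ₀.2 + z.2))

/-- The law of an observation when `θ` has density `δ`. -/
noncomputable def contLaw (ν : Measure (Cov p × ℝ)) (δ : ℝ → ℝ) : Measure (Obs p) :=
  densityLaw ν fun z y => margDensity δ z.2 y

theorem measurable_coreDensity :
    Measurable fun q : (Cov p × ℝ) × ℝ => phi q.2 (inner ℝ q.1.1 ψ₀.1) (ψ₀.2 + q.1.2) := by
  fun_prop

theorem measurable_margDensity (hδ : Measurable δ) :
    Measurable fun q : (Cov p × ℝ) × ℝ => margDensity δ q.1.2 q.2 := by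
  unfold margDensity
  refine Measurable.lintegral_prod_right'
    (f := fun r : ((Cov p × ℝ) × ℝ) × ℝ => ENNReal.ofReal (phi r.1.2 r.2 r.1.1.2 * δ r.2)) ?_
  fun_prop

theorem measurable_margDensity_right (hδ : Measurable δ) (D : ℝ) :
    Measurable fun y => margDensity δ D y := by
  unfold margDensity
  refine Measurable.lintegral_prod_right'
    (f := fun r : ℝ × ℝ => ENNReal.ofReal (phi r.1 r.2 D * δ r.2)) ?_
  fun_prop

theorem lintegral_contaminatedDensity_mul (hA : 0 < ψ₀.2) (hδ : IsProbDensity δ) {ω : ℝ}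
    (hω0 : 0 ≤ ω) (hω1 : ω ≤ 1) {D : ℝ} (hD : 0 < D) (x : Cov p) (y : ℝ) :
    ∫⁻ θ, ENNReal.ofReal (contaminatedDensity ω ψ₀ δ x θ * phi y θ D) =
      ENNReal.ofReal (1 - ω) * ENNReal.ofReal (phi y (inner ℝ x ψ₀.1) (ψ₀.2 + D)) +
        ENNReal.ofReal ω * margDensity δ D y := by
  have hδm := hδ.measurable
  have hsplit : ∀ θ, ENNReal.ofReal (contaminatedDensity ω ψ₀ δ x θ * phi y θ D) =
      ENNReal.ofReal (1 - ω) * ENNReal.ofReal (phi θ (inner ℝ x ψ₀.1) ψ₀.2 * phi y θ D) +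
        ENNReal.ofReal ω * ENNReal.ofReal (phi y θ D * δ θ) := by
    intro θ
    have h1 := phi_nonneg θ (inner ℝ x ψ₀.1) ψ₀.2
    have h2 := phi_nonneg y θ D
    have h3 := hδ.nonneg θ
    have h4 : 0 ≤ 1 - ω := by linarith
    rw [← ENNReal.ofReal_mul h4, ← ENNReal.ofReal_mul hω0,
      ← ENNReal.ofReal_add (by positivity) (by positivity), contaminatedDensity]
    congr 1
    ring
  simp only [hsplit]
  rw [lintegral_add_left (by fun_prop), lintegral_const_mul _ (by fun_prop),
    lintegral_const_mul _ (by fun_prop), lintegral_phi_mul_phi hA hD]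
  rfl

theorem isProbabilityMeasure_coreLaw (hDL : 0 < DL) (hD : ∀ᵐ z ∂ν, z.2 ∈ Set.Icc DL DU)
    (hA : 0 < ψ₀.2) : IsProbabilityMeasure (coreLaw ν ψ₀) := by
  refine isProbabilityMeasure_densityLaw measurable_coreDensity.ennreal_ofReal ?_
  filter_upwards [hD] with z hz
  exact lintegral_phi (by linarith [hz.1]) _

theorem lintegral_margDensity (hδ : IsProbDensity δ) {D : ℝ} (hD : 0 < D) :
    ∫⁻ y, margDensity δ D y = 1 := by
  have hδm := hδ.measurable
  unfold margDensity
  rw [lintegral_lintegral_swap (by fun_prop)]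
  simp_rw [ENNReal.ofReal_mul (phi_nonneg _ _ _)]
  rw [← hδ.lintegral_eq_one]
  congr 1 with θ
  rw [lintegral_mul_const _ (by fun_prop), lintegral_phi hD, one_mul]

theorem isProbabilityMeasure_contLaw (hDL : 0 < DL) (hD : ∀ᵐ z ∂ν, z.2 ∈ Set.Icc DL DU)
    (hδ : IsProbDensity δ) : IsProbabilityMeasure (contLaw ν δ) := by
  refine isProbabilityMeasure_densityLaw (measurable_margDensity hδ.measurable) ?_
  filter_upwards [hD] with z hz
  exact lintegral_margDensity hδ (by linarith [hz.1])

theorem obsLaw_eq (hDL : 0 < DL) (hD : ∀ᵐ z ∂ν, z.2 ∈ Set.Icc DL DU) (hA : 0 < ψ₀.2)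
    (hδ : IsProbDensity δ) {ω : ℝ} (hω0 : 0 ≤ ω) (hω1 : ω ≤ 1) :
    obsLaw ν ω ψ₀ δ =
      ENNReal.ofReal (1 - ω) • coreLaw ν ψ₀ + ENNReal.ofReal ω • contLaw ν δ := by
  have hδm := hδ.measurable
  have hδ0 := hδ.nonneg
  refine Measure.ext_of_lintegral _ fun f hf => ?_
  have hdm : Measurable fun z : (Cov p × ℝ) × (ℝ × ℝ) => ENNReal.ofReal
      (contaminatedDensity ω ψ₀ δ z.1.1 z.2.1 * phi z.2.2 z.2.1 z.1.2) := by
    unfold contaminatedDensity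
    fun_prop
  have hmc := (measurable_coreDensity (ψ₀ := ψ₀)).ennreal_ofReal
  have hmm := measurable_margDensity (p := p) hδm
  rw [lintegral_add_measure, lintegral_smul_measure, lintegral_smul_measure, coreLaw, contLaw,
    lintegral_densityLaw hmc hf, lintegral_densityLaw hmm hf, obsLaw,
    lintegral_map hf (by fun_prop), jointLaw,
    lintegral_withDensity_eq_lintegral_mul _ hdm (by fun_prop),
    lintegral_prod _ (by fun_prop), smul_eq_mul, smul_eq_mul]
  have hm1 : Measurable fun z : Cov p × ℝ =>
      ∫⁻ y, ENNReal.ofReal (phi y (inner ℝ z.1 ψ₀.1) (ψ₀.2 + z.2)) * f (y, z.1, z.2) :=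
    Measurable.lintegral_prod_right'
      (f := fun q : (Cov p × ℝ) × ℝ => ENNReal.ofReal
        (phi q.2 (inner ℝ q.1.1 ψ₀.1) (ψ₀.2 + q.1.2)) * f (q.2, q.1.1, q.1.2)) (by fun_prop)
  have hm2 : Measurable fun z : Cov p × ℝ =>
      ∫⁻ y, margDensity δ z.2 y * f (y, z.1, z.2) :=
    Measurable.lintegral_prod_right'
      (f := fun q : (Cov p × ℝ) × ℝ => margDensity δ q.1.2 q.2 * f (q.2, q.1.1, q.1.2))
      (by fun_prop)
  rw [← lintegral_const_mul _ hm1, ← lintegral_const_mul _ hm2,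
    ← lintegral_add_left (by fun_prop)]
  refine lintegral_congr_ae ?_
  filter_upwards [hD] with z hz
  have hz0 : 0 < z.2 := hDL.trans_le hz.1
  rw [lintegral_prod_symm _ (by fun_prop)]
  have hinner : ∀ y, (∫⁻ θ, ENNReal.ofReal (contaminatedDensity ω ψ₀ δ z.1 θ * phi y θ z.2) *
      f (y, z.1, z.2)) = ENNReal.ofReal (1 - ω) *
        (ENNReal.ofReal (phi y (inner ℝ z.1 ψ₀.1) (ψ₀.2 + z.2)) * f (y, z.1, z.2)) +
        ENNReal.ofReal ω * (margDensity δ z.2 y * f (y, z.1, z.2)) := by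
    intro y
    rw [lintegral_mul_const _ (by unfold contaminatedDensity; fun_prop),
      lintegral_contaminatedDensity_mul hA hδ hω0 hω1 hz0, add_mul, mul_assoc, mul_assoc]
  simp only [Pi.mul_apply, hinner]
  have hmm' := measurable_margDensity_right hδm z.2
  rw [lintegral_add_left (by fun_prop), lintegral_const_mul _ (by fun_prop),
    lintegral_const_mul _ (by fun_prop)]

/-- If y² ≥ 2/ε, the left side is at most ε/2. Otherwise (y − a)² ≤ 4/ε + 2B², the density is
bounded below by the displayed constant, and its normalized power is at least 1. -/
theorem inv_one_add_sq_le {γ Dₗ Dᵤ B ε a A D y : ℝ} (hγ : 0 ≤ γ) (hA : 0 < A) (hDL : 0 < Dₗ)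
    (hε : 0 < ε) (hD : D ∈ Set.Icc Dₗ Dᵤ) (ha : |a| ≤ B) :
    (1 + y ^ 2)⁻¹ ≤ ε / 2 + (((√(2 * Real.pi * (A + Dᵤ)))⁻¹ *
      Real.exp (-(4 / ε + 2 * B ^ 2) / (2 * Dₗ))) ^ γ)⁻¹ * phi y a (A + D) ^ γ := by
  have hπ := Real.pi_pos
  have hVu : 0 < A + Dᵤ := by linarith [hD.1.trans hD.2]
  have hV : 0 < A + D := by linarith [hD.1]
  have hφ := phi_pos hV y a
  set c₀ := (√(2 * Real.pi * (A + Dᵤ)))⁻¹ * Real.exp (-(4 / ε + 2 * B ^ 2) / (2 * Dₗ))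
  have hc₀ : 0 < c₀ := by positivity
  have hc : 0 < c₀ ^ γ := by positivity
  rcases le_total (2 / ε) (y ^ 2) with h | h
  · have : (1 + y ^ 2)⁻¹ ≤ ε / 2 := by
      rw [inv_le_comm₀ (by positivity) (by positivity), inv_div]
      linarith
    have : 0 < (c₀ ^ γ)⁻¹ * phi y a (A + D) ^ γ := by positivity
    linarith
  · have hB : a ^ 2 ≤ B ^ 2 := by
      rw [← sq_abs a]
      exact pow_le_pow_left₀ (abs_nonneg _) ha 2
    have h1 : (y - a) ^ 2 ≤ 4 / ε + 2 * B ^ 2 := by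
      have : 4 / ε = 2 * (2 / ε) := by ring
      nlinarith [sq_nonneg (y + a)]
    have h2 : c₀ ≤ phi y a (A + D) := by
      rw [phi_eq hV]
      have h3 : (y - a) ^ 2 / (2 * (A + D)) ≤ (4 / ε + 2 * B ^ 2) / (2 * Dₗ) := by
        gcongr
        linarith [hD.1]
      have h4 : A + D ≤ A + Dᵤ := by linarith [hD.2]
      refine mul_le_mul ?_ ?_ (Real.exp_pos _).le (by positivity)
      · gcongr
      · rw [Real.exp_le_exp, neg_div, neg_div]
        linarith
    have h5 : c₀ ^ γ ≤ phi y a (A + D) ^ γ := Real.rpow_le_rpow hc₀.le h2 hγ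
    have h6 : 1 ≤ (c₀ ^ γ)⁻¹ * phi y a (A + D) ^ γ := by
      rw [inv_mul_eq_div, one_le_div hc]
      exact h5
    have h7 : (1 + y ^ 2)⁻¹ ≤ 1 := inv_le_one_of_one_le₀ (by nlinarith [sq_nonneg y])
    linarith

/-- If the contamination is well separated from the model, then it is far from the origin. -/
theorem exists_rho_bound {X : Set (Cov p)} {γ : ℝ} (hDL : 0 < DL)
    (hX : Bornology.IsBounded X) (hD : ∀ᵐ z ∂ν, z.2 ∈ Set.Icc DL DU)
    (hxX : ∀ᵐ z ∂ν, z.1 ∈ X) (hA : 0 < ψ₀.2) (hγ : 0 ≤ γ) {ε : ℝ} (hε : 0 < ε) :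
    ∃ ρ₀, 0 < ρ₀ ∧ ∀ δ, IsProbDensity δ → rho X DL DU ψ₀ γ δ ≤ ENNReal.ofReal ρ₀ →
      ∫ w : Obs p, (1 + w.1 ^ 2)⁻¹ ∂(contLaw ν δ) ≤ ε := by
  have hπ := Real.pi_pos
  obtain ⟨M, hM⟩ := hX.exists_norm_le
  obtain ⟨z₁, hz₁⟩ := hD.exists
  have hVu : 0 < ψ₀.2 + DU := by linarith [hz₁.1.trans hz₁.2]
  obtain ⟨c, hc, hpoint⟩ : ∃ c : ℝ, 0 < c ∧ ∀ x ∈ X, ∀ D ∈ Set.Icc DL DU, ∀ y : ℝ,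
      (1 + y ^ 2)⁻¹ ≤ ε / 2 + c⁻¹ * phi y (inner ℝ x ψ₀.1) (ψ₀.2 + D) ^ γ :=
    ⟨_, by positivity, fun x hx D hD y => inv_one_add_sq_le hγ hA hDL hε hD
      ((abs_real_inner_le_norm _ _).trans
        (mul_le_mul_of_nonneg_right (hM x hx) (norm_nonneg _)))⟩
  -- The tail costs ε/2; the term c⁻¹ ∫ f_δ φ^γ costs c⁻¹ · (ε/2 · c), the other half of ε.
  refine ⟨ε / 2 * c, by positivity, fun δ hδ hρ => ?_⟩
  have hint : ∀ x ∈ X, ∀ D ∈ Set.Icc DL DU,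
      ∫⁻ y, margDensity δ D y *
        ENNReal.ofReal (phi y (inner ℝ x ψ₀.1) (ψ₀.2 + D) ^ γ) ≤ ENNReal.ofReal (ε / 2 * c) := by
    intro x hx D hD
    refine le_trans ?_ hρ
    unfold rho
    -- Only the moment k = 0 of ρ is needed.
    refine le_iSup₂_of_le 0 (by simp) (le_iSup₂_of_le D hD (le_iSup₂_of_le x hx ?_))
    simp only [pow_zero, mul_one, le_refl]
  have hmm := measurable_margDensity (p := p) hδ.measurable
  rw [integral_eq_lintegral_of_nonneg_ae (Eventually.of_forall fun w => by positivity)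
    (by fun_prop)]
  refine ENNReal.toReal_le_of_le_ofReal hε.le ?_
  rw [contLaw, lintegral_densityLaw hmm (by fun_prop)]
  have hinner : ∀ᵐ z ∂ν, ∫⁻ y, margDensity δ z.2 y * ENNReal.ofReal ((1 + y ^ 2)⁻¹) ≤
      ENNReal.ofReal ε := by
    filter_upwards [hD, hxX] with z hz hx
    have hmm' := measurable_margDensity_right hδ.measurable z.2
    calc ∫⁻ y, margDensity δ z.2 y * ENNReal.ofReal ((1 + y ^ 2)⁻¹)
        ≤ ∫⁻ y, (margDensity δ z.2 y * ENNReal.ofReal (ε / 2) +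
            ENNReal.ofReal c⁻¹ * (margDensity δ z.2 y *
              ENNReal.ofReal (phi y (inner ℝ z.1 ψ₀.1) (ψ₀.2 + z.2) ^ γ))) := by
          refine lintegral_mono fun y => ?_
          have hφ := phi_nonneg y (inner ℝ z.1 ψ₀.1) (ψ₀.2 + z.2)
          have h := ENNReal.ofReal_le_ofReal (hpoint z.1 hx z.2 hz y)
          rw [ENNReal.ofReal_add (by positivity) (by positivity),
            ENNReal.ofReal_mul (by positivity)] at h
          refine (mul_le_mul_right h (margDensity δ z.2 y)).trans_eq ?_
          rw [mul_add, mul_left_comm]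
      _ ≤ 1 * ENNReal.ofReal (ε / 2) +
            ENNReal.ofReal c⁻¹ * ENNReal.ofReal (ε / 2 * c) := by
          rw [lintegral_add_left (by fun_prop), lintegral_mul_const _ hmm',
            lintegral_margDensity hδ (hDL.trans_le hz.1),
            lintegral_const_mul _ (by fun_prop)]
          gcongr
          exact hint z.1 hx z.2 hz
      _ = ENNReal.ofReal ε := by
          rw [one_mul, ← ENNReal.ofReal_mul (by positivity),
            ← ENNReal.ofReal_add (by positivity) (by positivity)]
          congr 1
          field_simp
          ring
  exact (lintegral_mono_ae hinner).trans (by simp)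

end mixture


/-! ### Uniform law of large numbers over a compact parameter space -/

section uniformLaw

variable {K E : Type*} [TopologicalSpace K] [CompactSpace K] [TopologicalSpace E]
  [SecondCountableTopology E] [MeasurableSpace E] [OpensMeasurableSpace E]

theorem integrable_curry {F : Measure E} [IsFiniteMeasure F] (f : C(E × K, ℝ)) {C : ℝ}
    (hC : 0 ≤ C) (hf : ∀ᵐ z ∂F, ∀ ψ, |f (z, ψ)| ≤ C) : Integrable f.curry F := by
  refine Integrable.of_bound f.curry.continuous.aestronglyMeasurable C ?_
  filter_upwards [hf] with z hz
  rw [ContinuousMap.norm_le _ hC]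
  exact hz

theorem integral_curry_apply {F : Measure E} [IsFiniteMeasure F] (f : C(E × K, ℝ)) {C : ℝ}
    (hC : 0 ≤ C) (hf : ∀ᵐ z ∂F, ∀ ψ, |f (z, ψ)| ≤ C) (ψ : K) :
    (∫ z, f.curry z ∂F) ψ = ∫ z, f (z, ψ) ∂F :=
  (ContinuousLinearMap.integral_comp_comm (ContinuousMap.evalCLM ℝ ψ)
    (integrable_curry f hC hf)).symm

/-- The Bochner integral of the curried function is itself an element of `C(K, ℝ)`, so continuity in
the parameter is automatic. -/
theorem continuous_integral_of_bound {F : Measure E} [IsFiniteMeasure F] (f : C(E × K, ℝ))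
    {C : ℝ} (hC : 0 ≤ C) (hf : ∀ᵐ z ∂F, ∀ ψ, |f (z, ψ)| ≤ C) :
    Continuous fun ψ => ∫ z, f (z, ψ) ∂F := by
  simp_rw [← integral_curry_apply f hC hf]
  exact (∫ z, f.curry z ∂F).continuous

/-- This is the strong law in the Banach space `C(K, ℝ)`, applied to the random functions f(Zᵢ, ·):
convergence in the sup norm is uniformity in the parameter. With `K = Unit` it is the usual strong
law. -/
theorem uniform_strong_law {Ω : Type*} [MeasurableSpace Ω] {P : Measure Ω}
    {F : Measure E} [IsFiniteMeasure F] {Z : ℕ → Ω → E}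
    (hind : iIndepFun Z P) (hZ : ∀ i, HasLaw (Z i) F P) (f : C(E × K, ℝ)) {C : ℝ} (hC : 0 ≤ C)
    (hf : ∀ᵐ z ∂F, ∀ ψ, |f (z, ψ)| ≤ C) :
    ∀ᵐ s ∂P, ∀ ε, 0 < ε → ∀ᶠ m : ℕ in atTop, ∀ ψ : K,
      |(m : ℝ)⁻¹ * ∑ i ∈ Finset.range m, f (Z i s, ψ) - ∫ z, f (z, ψ) ∂F| ≤ ε := by
  let _ : MeasurableSpace C(K, ℝ) := borel _
  have _ : BorelSpace C(K, ℝ) := ⟨rfl⟩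
  have hm : Measurable f.curry := f.curry.continuous.measurable
  have hint := integrable_curry f hC hf
  have hlaw : ∀ i, IdentDistrib (Z i) (Z 0) P P := fun i => (hZ i).identDistrib (hZ 0)
  have hcomp : Integrable (fun s => f.curry (Z 0 s)) P := by
    have h := hint
    rw [← (hZ 0).map_eq] at h
    exact h.comp_aemeasurable (hZ 0).aemeasurable
  have hmean : ∫ s, f.curry (Z 0 s) ∂P = ∫ z, f.curry z ∂F := by
    rw [← (hZ 0).map_eq, integral_map (hZ 0).aemeasurable
      f.curry.continuous.aestronglyMeasurable]
  have hslln := strong_law_ae (μ := P) (fun i s => f.curry (Z i s)) hcomp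
    (fun i j hij => (hind.indepFun hij).comp hm hm) (fun i => (hlaw i).comp hm)
  filter_upwards [hslln] with s hs ε hε
  rw [hmean] at hs
  filter_upwards [(Metric.tendsto_nhds.1 hs) ε hε] with m hdist ψ
  rw [dist_eq_norm] at hdist
  have h := (ContinuousMap.norm_coe_le_norm _ ψ).trans hdist.le
  simpa [integral_curry_apply f hC hf] using h

end uniformLaw


/-! ### Continuous versions of the objective and of the variance term -/

section clipped

variable {p : ℕ} {Ψ : Set (Param p)} {γ DL : ℝ}

theorem continuous_weight_clipped (hγ : 0 ≤ γ) (hDL : 0 < DL) (hΨpos : ∀ ψ ∈ Ψ, 0 < ψ.2) :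
    Continuous fun q : Obs p × Ψ => weight γ q.1.1 q.1.2.1 (max q.1.2.2 DL) q.2.1 := by
  have hV : ∀ q : Obs p × Ψ, 0 < q.2.1.2 + max q.1.2.2 DL := fun q =>
    add_pos (hΨpos _ q.2.2) (hDL.trans_le (le_max_right _ _))
  have hV' : ∀ q : Obs p × Ψ, 2 * (q.2.1.2 + max q.1.2.2 DL) ≠ 0 := fun q =>
    (mul_pos two_pos (hV q)).ne'
  simp_rw [fun q : Obs p × Ψ => weight_eq hγ (hV q) q.1.1 q.1.2.1]
  refine Continuous.mul (Continuous.rpow_const (by fun_prop) fun q => Or.inl ?_)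
    (Real.continuous_exp.comp ((Continuous.div (by fun_prop) (by fun_prop) hV').neg))
  exact (mul_pos (mul_pos two_pos Real.pi_pos) (hV q)).ne'

/-- The objective `𝒟_γ` as a continuous function; `D` is cut off below at `DL`. -/
noncomputable def clippedLik (hγ : 0 < γ) (hDL : 0 < DL) (hΨpos : ∀ ψ ∈ Ψ, 0 < ψ.2) :
    C(Obs p × Ψ, ℝ) where
  toFun q := gammaLik γ q.1.1 q.1.2.1 (max q.1.2.2 DL) q.2.1
  continuous_toFun := by
    simp only [gammaLik, if_neg hγ.ne']
    exact continuous_const.mul (continuous_weight_clipped hγ.le hDL hΨpos)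

/-- The variance term as a continuous function; `D` is cut off below at `DL`. -/
noncomputable def clippedVar (hγ : 0 < γ) (hDL : 0 < DL) (hΨpos : ∀ ψ ∈ Ψ, 0 < ψ.2) :
    C(Obs p × Ψ, ℝ) where
  toFun q := varTerm γ q.1.1 q.1.2.1 (max q.1.2.2 DL) q.2.1
  continuous_toFun := by
    unfold varTerm
    have hV : ∀ q : Obs p × Ψ, (q.2.1.2 + max q.1.2.2 DL) ^ 2 ≠ 0 := fun q =>
      (pow_pos (add_pos (hΨpos _ q.2.2) (hDL.trans_le (le_max_right _ _))) 2).ne'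
    exact ((continuous_weight_clipped hγ.le hDL hΨpos).mul
      (Continuous.div (by fun_prop) (by fun_prop) hV)).mul (by fun_prop)

end clipped

/-! ### Population quantities under the Gaussian model -/

section population

variable {p : ℕ} {ν : Measure (Cov p × ℝ)} {X : Set (Cov p)}
  {DL DU : ℝ} {ψ₀ : Param p}

/-- If xᵀ(β − β') = 0 almost surely, then E[xxᵀ](β − β') = 0, and the second moment matrix is
invertible. -/
theorem eq_of_ae_inner_eq [IsFiniteMeasure ν] (hX : Bornology.IsBounded X) (hxX : ∀ᵐ z ∂ν, z.1 ∈ X)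
    (hxx : (Matrix.of fun j k : Fin p => ∫ z, z.1 j * z.1 k ∂ν).PosDef) {β β' : Cov p}
    (h : ∀ᵐ z ∂ν, (inner ℝ z.1 β : ℝ) = inner ℝ z.1 β') : β = β' := by
  obtain ⟨M, hM⟩ := hX.exists_norm_le
  have hint : ∀ j k : Fin p, Integrable (fun z : Cov p × ℝ => z.1 j * z.1 k) ν := by
    intro j k
    refine Integrable.of_bound (by fun_prop) (M * M) ?_
    filter_upwards [hxX] with z hz
    rw [norm_mul]
    have h1 := (PiLp.norm_apply_le z.1 j).trans (hM _ hz)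
    have h2 := (PiLp.norm_apply_le z.1 k).trans (hM _ hz)
    exact mul_le_mul h1 h2 (norm_nonneg _) ((norm_nonneg _).trans h1)
  have hker : (Matrix.of fun j k : Fin p => ∫ z, z.1 j * z.1 k ∂ν).mulVec
      (fun k => (β - β') k) = 0 := by
    ext j
    simp only [Matrix.mulVec, dotProduct, Matrix.of_apply, Pi.zero_apply]
    simp_rw [← integral_mul_const]
    rw [← integral_finsetSum _ fun k _ => (hint j k).mul_const _]
    refine (integral_congr_ae ?_).trans (integral_zero' _ _)
    filter_upwards [h] with z hz
    have : ∑ k, z.1 k * (β - β') k = 0 := by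
      have h0 : (inner ℝ z.1 (β - β') : ℝ) = 0 := by rw [inner_sub_right, hz, sub_self]
      rw [← h0, PiLp.inner_apply]
      exact Finset.sum_congr rfl fun k _ => by simp [mul_comm]
    simp_rw [mul_assoc]
    rw [← Finset.mul_sum, this]
    simp
  have hz := Matrix.eq_zero_of_mulVec_eq_zero hxx.det_pos.ne' hker
  ext k
  exact sub_eq_zero.1 (congrFun hz k)

theorem ae_densityLaw_mem {g : Cov p × ℝ → ℝ → ℝ≥0∞} (hD : ∀ᵐ z ∂ν, z.2 ∈ Set.Icc DL DU)
    (hxX : ∀ᵐ z ∂ν, z.1 ∈ X) :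
    ∀ᵐ w ∂(densityLaw ν g), w.2.1 ∈ X ∧ w.2.2 ∈ Set.Icc DL DU :=
  quasiMeasurePreserving_snd_densityLaw.ae (hxX.and hD)

theorem integral_coreLaw [SFinite ν] (hD : ∀ᵐ z ∂ν, z.2 ∈ Set.Icc DL DU) {f : ℝ → Cov p → ℝ → ℝ}
    (hfm : Measurable fun w : Obs p => f w.1 w.2.1 (max w.2.2 DL))
    (hf : Integrable (fun w : Obs p => f w.1 w.2.1 (max w.2.2 DL)) (coreLaw ν ψ₀)) :
    Integrable (fun z : Cov p × ℝ =>
      ∫ y, phi y (inner ℝ z.1 ψ₀.1) (ψ₀.2 + z.2) * f y z.1 z.2) ν ∧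
    ∫ w, f w.1 w.2.1 (max w.2.2 DL) ∂(coreLaw ν ψ₀) =
      ∫ z, (∫ y, phi y (inner ℝ z.1 ψ₀.1) (ψ₀.2 + z.2) * f y z.1 z.2) ∂ν := by
  obtain ⟨h1, h2⟩ := integral_densityLaw (k := fun z y => phi y (inner ℝ z.1 ψ₀.1) (ψ₀.2 + z.2))
    measurable_coreDensity (fun _ _ => phi_nonneg _ _ _) hfm hf
  have hae : (fun z : Cov p × ℝ =>
      ∫ y, phi y (inner ℝ z.1 ψ₀.1) (ψ₀.2 + z.2) * f y z.1 (max z.2 DL)) =ᵐ[ν]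
      fun z => ∫ y, phi y (inner ℝ z.1 ψ₀.1) (ψ₀.2 + z.2) * f y z.1 z.2 := by
    filter_upwards [hD] with z hz
    rw [max_eq_left hz.1]
  exact ⟨h1.congr hae, h2.trans (integral_congr_ae hae)⟩

theorem Q_eq (hA : 0 < ψ₀.2) (hDL : 0 < DL) (hD : ∀ᵐ z ∂ν, z.2 ∈ Set.Icc DL DU) (γ : ℝ)
    (ψ : Param p) : Q ν ψ₀ γ ψ =
      ∫ z, (∫ y, phi y (inner ℝ z.1 ψ₀.1) (ψ₀.2 + z.2) * varTerm γ y z.1 z.2 ψ) ∂ν := by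
  refine integral_congr_ae ?_
  filter_upwards [hD] with z hz
  have hV : 0 < ψ₀.2 + z.2 := by linarith [hz.1]
  rw [integral_gaussianReal_eq_integral_smul (by simpa using hV)]
  rfl

theorem Q_zero (hA : 0 < ψ₀.2) (hDL : 0 < DL) (hD : ∀ᵐ z ∂ν, z.2 ∈ Set.Icc DL DU) :
    Q ν ψ₀ 0 ψ₀ = -∫ z, z.2 ^ 2 / (ψ₀.2 + z.2) ∂ν := by
  rw [← integral_neg]
  refine integral_congr_ae ?_
  filter_upwards [hD] with z hz
  have hV : 0 < ψ₀.2 + z.2 := by linarith [hz.1]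
  simp [varTerm_zero hV]

/-- The conditional inequality `integral_weight_le` holds for each (x, D). Equality of the integrals
would force equality for almost every (x, D), hence equal A and equal xᵀβ almost surely, which
identifies ψ. -/
theorem integral_gammaLik_lt [IsProbabilityMeasure ν] {Ψ : Set (Param p)} {γ C : ℝ} (hγ : 0 < γ) (hDL : 0 < DL)
    (hΨpos : ∀ ψ ∈ Ψ, 0 < ψ.2) (hD : ∀ᵐ z ∂ν, z.2 ∈ Set.Icc DL DU)
    (hX : Bornology.IsBounded X) (hxX : ∀ᵐ z ∂ν, z.1 ∈ X)
    (hxx : (Matrix.of fun j k : Fin p => ∫ z, z.1 j * z.1 k ∂ν).PosDef)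
    (ψ₀ ψ : Ψ) (hne : ψ ≠ ψ₀)
    (hC : ∀ᵐ w ∂(coreLaw ν ψ₀.1), ∀ ψ : Ψ, |clippedLik hγ hDL hΨpos (w, ψ)| ≤ C) :
    ∫ w, clippedLik hγ hDL hΨpos (w, ψ) ∂(coreLaw ν ψ₀.1) <
      ∫ w, clippedLik hγ hDL hΨpos (w, ψ₀) ∂(coreLaw ν ψ₀.1) := by
  have hA : 0 < ψ₀.1.2 := hΨpos _ ψ₀.2
  have hprob := isProbabilityMeasure_coreLaw hDL hD hA
  have hcont : ∀ ψ : Ψ, Continuous fun w : Obs p => clippedLik hγ hDL hΨpos (w, ψ) := fun ψ => by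
    fun_prop
  have hint : ∀ ψ : Ψ,
      Integrable (fun w => clippedLik hγ hDL hΨpos (w, ψ)) (coreLaw ν ψ₀.1) := fun ψ =>
    Integrable.of_bound (hcont ψ).aestronglyMeasurable C (hC.mono fun w hw => hw ψ)
  have hrep : ∀ ψ : Ψ, _ := fun ψ =>
    integral_coreLaw (ν := ν) hD (f := fun y x D => gammaLik γ y x D ψ.1)
      (hcont ψ).measurable (hint ψ)
  obtain ⟨hi, he⟩ := hrep ψ
  obtain ⟨hi₀, he₀⟩ := hrep ψ₀
  simp only [gammaLik, if_neg hγ.ne', mul_left_comm _ (1 / γ), integral_const_mul] at hi he hi₀ he₀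
  have hγ' : 0 < 1 / γ := by positivity
  have hle : ∀ᵐ z ∂ν,
      1 / γ * ∫ y, phi y (inner ℝ z.1 ψ₀.1.1) (ψ₀.1.2 + z.2) * weight γ y z.1 z.2 ψ.1 ≤
      1 / γ * ∫ y, phi y (inner ℝ z.1 ψ₀.1.1) (ψ₀.1.2 + z.2) * weight γ y z.1 z.2 ψ₀.1 := by
    filter_upwards [hD] with z hz
    have h0 : 0 < z.2 := hDL.trans_le hz.1
    exact mul_le_mul_of_nonneg_left (integral_weight_le hγ (add_pos (hΨpos _ ψ.2) h0)
      (add_pos hA h0) z.1).1 hγ'.le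
  have hmono := integral_mono_ae hi hi₀ hle
  have hval : ∀ ψ : Ψ, (fun w => clippedLik hγ hDL hΨpos (w, ψ)) =
      fun w : Obs p => 1 / γ * weight γ w.1 w.2.1 (max w.2.2 DL) ψ.1 := fun ψ => by
    ext w
    simp [clippedLik, gammaLik, hγ.ne']
  rw [hval, hval, integral_const_mul, integral_const_mul, he, he₀, ← integral_const_mul,
    ← integral_const_mul]
  refine lt_of_le_of_ne hmono fun heq => hne ?_
  have hae := (integral_eq_iff_of_ae_le hi hi₀ hle).1 heq
  have hboth : ∀ᵐ z ∂ν, (inner ℝ z.1 ψ.1.1 : ℝ) = inner ℝ z.1 ψ₀.1.1 ∧ ψ.1.2 = ψ₀.1.2 := by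
    filter_upwards [hD, hae] with z hz hz'
    have h0 : 0 < z.2 := hDL.trans_le hz.1
    exact (integral_weight_le hγ (add_pos (hΨpos _ ψ.2) h0) (add_pos hA h0) z.1).2
      (mul_left_cancel₀ hγ'.ne' hz')
  obtain ⟨z, hz⟩ := hboth.exists
  exact Subtype.ext (Prod.ext (eq_of_ae_inner_eq hX hxX hxx (hboth.mono fun _ h => h.1)) hz.2)

end population

/-- Near-maximizers of `H` have values of `V` not much larger than at the unique maximizer. -/
theorem exists_gap {K : Type*} [TopologicalSpace K] [CompactSpace K] {H V : K → ℝ}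
    (hH : Continuous H) (hV : Continuous V) {k₀ : K} (hmax : ∀ k, k ≠ k₀ → H k < H k₀) {κ : ℝ}
    (hκ : 0 < κ) : ∃ η, 0 < η ∧ ∀ k, H k₀ - η ≤ H k → V k < V k₀ + κ := by
  have hcl : IsCompact {k | V k₀ + κ ≤ V k} := (isClosed_le continuous_const hV).isCompact
  rcases Set.eq_empty_or_nonempty {k | V k₀ + κ ≤ V k} with he | hne
  · refine ⟨1, one_pos, fun k _ => ?_⟩
    by_contra! hk
    exact (he ▸ hk : k ∈ (∅ : Set K))
  · obtain ⟨k₁, hk₁, hk₁'⟩ := hcl.exists_isMaxOn hne hH.continuousOn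
    have hk₁V : V k₀ + κ ≤ V k₁ := hk₁
    have hlt : H k₁ < H k₀ := hmax k₁ (by rintro rfl; linarith)
    refine ⟨(H k₀ - H k₁) / 2, by linarith, fun k hk => ?_⟩
    by_contra! hk'
    have : H k ≤ H k₁ := hk₁' hk'
    linarith

/-! ### The marginal likelihood penalizes small variances when the data are spread out -/

theorem log_phi {v : ℝ} (hv : 0 < v) (y μ : ℝ) :
    Real.log (phi y μ v) =
      -(Real.log (2 * Real.pi) + Real.log v) / 2 - (y - μ) ^ 2 / (2 * v) := by
  have hπ := Real.pi_pos
  rw [phi_eq hv, Real.log_mul (by positivity) (Real.exp_pos _).ne', Real.log_inv, Real.log_exp,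
    Real.log_sqrt (by positivity), Real.log_mul (by positivity) hv.ne']
  ring

/-- In the log-likelihood difference, lowering A by ε raises the coefficient of the squared residual
by at least k = ε/(2(A⋆ + D_U)²). Centering the residual leaves k/2 on y², and absorbing the cross
term q|y| by Young's inequality leaves k/4. The logarithms stay bounded because A + D ≥ D_L. -/
theorem exists_gammaLik_zero_gap {p : ℕ} {DL DU B ε : ℝ} {ψ₀ : Param p} (hDL : 0 < DL)
    (hDU : 0 < DU) (hA : 0 < ψ₀.2) (hε : 0 < ε) :
    ∃ c C, 0 < c ∧ ∀ (ψ : Param p) (y : ℝ) (x : Cov p) (D : ℝ), D ∈ Set.Icc DL DU →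
      0 < ψ.2 → ψ.2 ≤ ψ₀.2 - ε → |inner ℝ x ψ.1| ≤ B → |inner ℝ x ψ₀.1| ≤ B →
      c * y ^ 2 - C ≤ gammaLik 0 y x D ψ₀ - gammaLik 0 y x D ψ := by
  set k := ε / (2 * (ψ₀.2 + DU) ^ 2)
  have hk : 0 < k := by positivity
  set q := 2 * B / DL with hq
  refine ⟨k / 4, k * B ^ 2 + q ^ 2 / k + B ^ 2 / (2 * DL) +
    (Real.log (ψ₀.2 + DU) - Real.log DL) / 2, by positivity,
    fun ψ y x D hD hψ hψε hB hB₀ => ?_⟩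
  have hD0 : 0 < D := hDL.trans_le hD.1
  have hV : 0 < ψ.2 + D := by positivity
  have hV₀ : 0 < ψ₀.2 + D := by positivity
  simp only [gammaLik, if_true]
  rw [log_phi hV, log_phi hV₀]
  set a : ℝ := inner ℝ x ψ.1
  set b : ℝ := inner ℝ x ψ₀.1
  have hlog1 : Real.log DL ≤ Real.log (ψ.2 + D) := Real.log_le_log hDL (by linarith [hD.1])
  have hlog2 : Real.log (ψ₀.2 + D) ≤ Real.log (ψ₀.2 + DU) :=
    Real.log_le_log hV₀ (by linarith [hD.2])
  have hkle : 1 / (2 * (ψ₀.2 + D)) + k ≤ 1 / (2 * (ψ.2 + D)) := by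
    have h1 : 1 / (2 * (ψ.2 + D)) - 1 / (2 * (ψ₀.2 + D)) =
        (ψ₀.2 - ψ.2) / (2 * ((ψ.2 + D) * (ψ₀.2 + D))) := by
      field_simp
      ring
    have h2 : k ≤ (ψ₀.2 - ψ.2) / (2 * ((ψ.2 + D) * (ψ₀.2 + D))) := by
      have : (ψ.2 + D) * (ψ₀.2 + D) ≤ (ψ₀.2 + DU) ^ 2 := by
        rw [sq]
        exact mul_le_mul (by linarith [hD.2]) (by linarith [hD.2]) hV₀.le (by positivity)
      exact div_le_div₀ (by linarith) (by linarith) (by positivity) (by linarith)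
    linarith
  have ha2 : a ^ 2 ≤ B ^ 2 := by
    rw [← sq_abs a]; exact pow_le_pow_left₀ (abs_nonneg _) hB 2
  have hb2 : b ^ 2 ≤ B ^ 2 := by
    rw [← sq_abs b]; exact pow_le_pow_left₀ (abs_nonneg _) hB₀ 2
  have hB0 : 0 ≤ B := (abs_nonneg _).trans hB
  have hya : |y * a| ≤ |y| * B := by rw [abs_mul]; gcongr
  have hyb : |y * b| ≤ |y| * B := by rw [abs_mul]; gcongr
  have hdiff : -(4 * B * |y| + B ^ 2) ≤ (y - a) ^ 2 - (y - b) ^ 2 := by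
    have h1 := (abs_le.1 hya).2
    have h2 := (abs_le.1 hyb).1
    nlinarith [sq_nonneg a]
  have hsum : (y - a) ^ 2 / (2 * (ψ.2 + D)) - (y - b) ^ 2 / (2 * (ψ₀.2 + D)) ≥
      k * (y ^ 2 / 2 - B ^ 2) - (q * |y| + B ^ 2 / (2 * DL)) := by
    have h1 : (1 / (2 * (ψ₀.2 + D)) + k) * (y - a) ^ 2 ≤
        1 / (2 * (ψ.2 + D)) * (y - a) ^ 2 := mul_le_mul_of_nonneg_right hkle (sq_nonneg _)
    have h2 : k * (y ^ 2 / 2 - B ^ 2) ≤ k * (y - a) ^ 2 := by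
      refine mul_le_mul_of_nonneg_left ?_ hk.le
      nlinarith [sq_nonneg (y - 2 * a)]
    have h3 : -(q * |y| + B ^ 2 / (2 * DL)) ≤
        1 / (2 * (ψ₀.2 + D)) * ((y - a) ^ 2 - (y - b) ^ 2) := by
      have h4 : 1 / (2 * (ψ₀.2 + D)) ≤ 1 / (2 * DL) :=
        one_div_le_one_div_of_le (by positivity) (by linarith [hD.1])
      have h5 : 1 / (2 * (ψ₀.2 + D)) * (4 * B * |y| + B ^ 2) ≤
          1 / (2 * DL) * (4 * B * |y| + B ^ 2) :=
        mul_le_mul_of_nonneg_right h4 (by positivity)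
      have h6 : 1 / (2 * DL) * (4 * B * |y| + B ^ 2) = q * |y| + B ^ 2 / (2 * DL) := by
        rw [hq]; field_simp; ring
      have h7 := mul_le_mul_of_nonneg_left hdiff (show 0 ≤ 1 / (2 * (ψ₀.2 + D)) by positivity)
      linarith
    have e1 : (y - a) ^ 2 / (2 * (ψ.2 + D)) = 1 / (2 * (ψ.2 + D)) * (y - a) ^ 2 := by ring
    have e2 : (y - b) ^ 2 / (2 * (ψ₀.2 + D)) = 1 / (2 * (ψ₀.2 + D)) * (y - b) ^ 2 := by ring
    rw [e1, e2]
    linarith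
  have hqy : q * |y| ≤ k / 4 * y ^ 2 + q ^ 2 / k := by
    have : k / 4 * y ^ 2 + q ^ 2 / k - q * |y| = k * (|y| / 2 - q / k) ^ 2 := by
      rw [← sq_abs y]; field_simp; ring
    have : 0 ≤ k * (|y| / 2 - q / k) ^ 2 := by positivity
    linarith
  linarith


/-! ### Expectations under the contaminated model -/

section contaminated

variable {p : ℕ} {ν : Measure (Cov p × ℝ)} {DL DU ω : ℝ}
  {ψ₀ : Param p} {δ : ℝ → ℝ}

theorem isProbabilityMeasure_obsLaw [IsProbabilityMeasure ν] (hDL : 0 < DL)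
    (hD : ∀ᵐ z ∂ν, z.2 ∈ Set.Icc DL DU)
    (hA : 0 < ψ₀.2) (hδ : IsProbDensity δ) (hω0 : 0 ≤ ω) (hω1 : ω ≤ 1) :
    IsProbabilityMeasure (obsLaw ν ω ψ₀ δ) := by
  have h1 := isProbabilityMeasure_coreLaw hDL hD hA
  have h2 := isProbabilityMeasure_contLaw hDL hD hδ
  constructor
  rw [obsLaw_eq hDL hD hA hδ hω0 hω1]
  simp only [Measure.coe_add, Measure.coe_smul, Pi.add_apply, Pi.smul_apply, measure_univ,
    smul_eq_mul, mul_one]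
  rw [← ENNReal.ofReal_add (by linarith) hω0]
  simp

theorem integral_obsLaw [IsProbabilityMeasure ν] (hDL : 0 < DL)
    (hD : ∀ᵐ z ∂ν, z.2 ∈ Set.Icc DL DU)
    (hA : 0 < ψ₀.2) (hδ : IsProbDensity δ) (hω0 : 0 ≤ ω) (hω1 : ω ≤ 1) {f : Obs p → ℝ}
    (hf₀ : Integrable f (coreLaw ν ψ₀)) (hf₁ : Integrable f (contLaw ν δ)) :
    ∫ w, f w ∂(obsLaw ν ω ψ₀ δ) =
      (1 - ω) * ∫ w, f w ∂(coreLaw ν ψ₀) + ω * ∫ w, f w ∂(contLaw ν δ) := by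
  rw [obsLaw_eq hDL hD hA hδ hω0 hω1,
    integral_add_measure (hf₀.smul_measure ENNReal.ofReal_ne_top)
      (hf₁.smul_measure ENNReal.ofReal_ne_top),
    integral_smul_measure, integral_smul_measure, ENNReal.toReal_ofReal (by linarith),
    ENNReal.toReal_ofReal hω0, smul_eq_mul, smul_eq_mul]

theorem ae_obsLaw [IsProbabilityMeasure ν] (hDL : 0 < DL)
    (hD : ∀ᵐ z ∂ν, z.2 ∈ Set.Icc DL DU)
    (hA : 0 < ψ₀.2) (hδ : IsProbDensity δ) (hω0 : 0 ≤ ω) (hω1 : ω ≤ 1) {s : Obs p → Prop}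
    (hs₀ : ∀ᵐ w ∂(coreLaw ν ψ₀), s w) (hs₁ : ∀ᵐ w ∂(contLaw ν δ), s w) :
    ∀ᵐ w ∂(obsLaw ν ω ψ₀ δ), s w := by
  rw [obsLaw_eq hDL hD hA hδ hω0 hω1, ae_add_measure_iff]
  exact ⟨Measure.ae_smul_measure hs₀ _, Measure.ae_smul_measure hs₁ _⟩

theorem hasLaw_obs {Ω : Type*} [MeasurableSpace Ω] {P : Measure Ω} {x : Ω → Cov p}
    {D θ y : Ω → ℝ}
    (h : HasLaw (fun s => ((x s, D s), (θ s, y s))) (jointLaw ν ω ψ₀ δ) P) :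
    HasLaw (fun s => (y s, x s, D s)) (obsLaw ν ω ψ₀ δ) P := by
  have hm : Measurable fun z : (Cov p × ℝ) × (ℝ × ℝ) => (z.2.2, z.1.1, z.1.2) := by fun_prop
  exact HasLaw.comp (X := fun s => ((x s, D s), (θ s, y s))) ⟨hm.aemeasurable, rfl⟩ h

end contaminated

/-! ### Selection in a fixed sample -/

section sample

variable {p : ℕ} {Ψ : Set (Param p)} {ψ₀ : Param p} {DL DU B ε c C : ℝ} {m : ℕ} {y : ℕ → ℝ}
  {x : ℕ → Cov p} {D : ℕ → ℝ}

/-- Were the estimated A too small, summing the gap over the sample would give ψ₀ a strictly larger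
likelihood as soon as the mean of y² exceeds C/c. -/
theorem le_estimate_snd (hΨpos : ∀ ψ ∈ Ψ, 0 < ψ.2) (hψ₀ : ψ₀ ∈ Ψ)
    (hgap : ∀ (ψ : Param p) (y : ℝ) (x : Cov p) (D : ℝ), D ∈ Set.Icc DL DU →
      0 < ψ.2 → ψ.2 ≤ ψ₀.2 - ε → |inner ℝ x ψ.1| ≤ B → |inner ℝ x ψ₀.1| ≤ B →
      c * y ^ 2 - C ≤ gammaLik 0 y x D ψ₀ - gammaLik 0 y x D ψ)
    (hD : ∀ i, D i ∈ Set.Icc DL DU) (hB : ∀ i, ∀ ψ ∈ Ψ, |inner ℝ (x i) ψ.1| ≤ B)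
    (hy : m * C < c * ∑ i ∈ Finset.range m, y i ^ 2) {ψ : Param p}
    (hψ : IsEstimate Ψ 0 m y x D ψ) : ψ₀.2 - ε ≤ ψ.2 := by
  by_contra! hlt
  have h1 : ∑ i ∈ Finset.range m, (c * y i ^ 2 - C) ≤
      ∑ i ∈ Finset.range m,
        (gammaLik 0 (y i) (x i) (D i) ψ₀ - gammaLik 0 (y i) (x i) (D i) ψ) :=
    Finset.sum_le_sum fun i _ => hgap ψ (y i) (x i) (D i) (hD i) (hΨpos ψ hψ.1) hlt.le
      (hB i ψ hψ.1) (hB i ψ₀ hψ₀)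
  have h2 := hψ.2 hψ₀
  simp only [Set.mem_ofPred_eq] at h2
  rw [Finset.sum_sub_distrib, Finset.sum_sub_distrib, ← Finset.mul_sum, Finset.sum_const,
    Finset.card_range, nsmul_eq_mul] at h1
  linarith

/-- The map A ↦ −D²/(A + D) is increasing, with difference quotients at most 1 because D² ≤ (A +
D)(A⋆ + D). -/
theorem le_varTerm_zero {ψ : Param p} {x : Cov p} {y D : ℝ} (hA₀ : 0 < ψ₀.2) (hA : 0 < ψ.2)
    (hD : 0 < D) (hε : 0 ≤ ε) (h : ψ₀.2 - ε ≤ ψ.2) :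
    -(D ^ 2 / (ψ₀.2 + D)) - ε ≤ varTerm 0 y x D ψ := by
  rw [varTerm_zero (by positivity)]
  have h1 : D ^ 2 / (ψ.2 + D) - D ^ 2 / (ψ₀.2 + D) =
      D ^ 2 * (ψ₀.2 - ψ.2) / ((ψ.2 + D) * (ψ₀.2 + D)) := by
    field_simp
    ring
  have h2 : D ^ 2 * (ψ₀.2 - ψ.2) / ((ψ.2 + D) * (ψ₀.2 + D)) ≤ ε := by
    rw [div_le_iff₀ (by positivity)]
    have h3 : D ^ 2 ≤ (ψ.2 + D) * (ψ₀.2 + D) := by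
      nlinarith [mul_pos hA hA₀, mul_pos hA hD, mul_pos hA₀ hD]
    calc D ^ 2 * (ψ₀.2 - ψ.2) ≤ D ^ 2 * ε := by gcongr; linarith
      _ ≤ ((ψ.2 + D) * (ψ₀.2 + D)) * ε := by gcongr
      _ = _ := mul_comm _ _
  linarith

theorem selected_ne_zero {Γ : Finset ℝ} {γ q v : ℝ} {ψhat : ℝ → Param p} {γop : ℝ}
    (hm : 0 < m) (hA₀ : 0 < ψ₀.2) (hΨpos : ∀ ψ ∈ Ψ, 0 < ψ.2) (hDL : 0 < DL) (hε : 0 ≤ ε)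
    (hγ : γ ∈ Γ) (hD : ∀ i, D i ∈ Set.Icc DL DU) (hmem : ψhat 0 ∈ Ψ)
    (hscale : ψ₀.2 - ε ≤ (ψhat 0).2)
    (hd : (m : ℝ)⁻¹ * ∑ i ∈ Finset.range m, D i ^ 2 / (ψ₀.2 + D i) ≤ q)
    (hv : (m : ℝ)⁻¹ * ∑ i ∈ Finset.range m, varTerm γ (y i) (x i) (D i) (ψhat γ) ≤ v)
    (hlt : v < -q - ε) (hsel : IsSelected Γ m y x D ψhat γop) : γop ≠ 0 := by
  rintro rfl
  have h1 := hsel.2 hγ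
  simp only [Set.mem_ofPred_eq, robustVar, Finset.sum_add_distrib] at h1
  have h2 : ∑ i ∈ Finset.range m, (-(D i ^ 2 / (ψ₀.2 + D i)) - ε) ≤
      ∑ i ∈ Finset.range m, varTerm 0 (y i) (x i) (D i) (ψhat 0) :=
    Finset.sum_le_sum fun i _ =>
      le_varTerm_zero hA₀ (hΨpos _ hmem) (hDL.trans_le (hD i).1) hε hscale
  rw [Finset.sum_sub_distrib, Finset.sum_neg_distrib, Finset.sum_const, Finset.card_range,
    nsmul_eq_mul] at h2
  have hm' : (0 : ℝ) < m := by exact_mod_cast hm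
  rw [inv_mul_le_iff₀ hm'] at hd hv
  have := mul_lt_mul_of_pos_left hlt hm'
  linarith

end sample

/-! ### From almost sure eventual validity to convergence of probabilities -/

/-- Continuity from below along the increasing sets where `q` holds from time n on. It needs no
measurability of these sets, so the estimates and the selected parameter may be arbitrary functions
on the sample space. -/
theorem tendsto_measure_setOf_of_ae_eventually {Ω : Type*} [MeasurableSpace Ω] {P : Measure Ω}
    [IsProbabilityMeasure P] {q : ℕ → Ω → Prop} (h : ∀ᵐ s ∂P, ∀ᶠ m in atTop, q m s) :
    Tendsto (fun m => P {s | q m s}) atTop (𝓝 1) := by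
  set S : ℕ → Set Ω := fun n => {s | ∀ m, n ≤ m → q m s}
  have hmono : Monotone S := fun a b hab s hs m hm => hs m (hab.trans hm)
  have hunion : P (⋃ n, S n) = 1 := by
    rw [← measure_univ (μ := P)]
    refine measure_congr (eventuallyEq_univ.2 ?_)
    filter_upwards [h] with s hs
    obtain ⟨n, hn⟩ := eventually_atTop.1 hs
    exact Set.mem_iUnion.2 ⟨n, hn⟩
  have hlim := tendsto_measure_iUnion_atTop (μ := P) hmono
  rw [hunion] at hlim
  exact tendsto_of_tendsto_of_tendsto_of_le_of_le hlim tendsto_const_nhds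
    (fun n => measure_mono fun s hs => hs n le_rfl) (fun n => prob_le_one)


/-! ### The sample quantities for large samples -/

section asymptotics

variable {p : ℕ} {ν : Measure (Cov p × ℝ)} {X : Set (Cov p)}
  {DL DU B C ω γ : ℝ} {Ψ : Set (Param p)} {ψ₀ : Param p} {δ : ℝ → ℝ}

theorem ae_clipped_bound {g : Cov p × ℝ → ℝ → ℝ≥0∞} (hγ : 0 < γ) (hDL : 0 < DL)
    (hΨpos : ∀ ψ ∈ Ψ, 0 < ψ.2) (hD : ∀ᵐ z ∂ν, z.2 ∈ Set.Icc DL DU) (hxX : ∀ᵐ z ∂ν, z.1 ∈ X)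
    (hbound : ∀ ψ ∈ Ψ, ∀ (y : ℝ), ∀ x ∈ X, ∀ D ∈ Set.Icc DL DU,
      |gammaLik γ y x D ψ| ≤ C * (1 + y ^ 2)⁻¹ ∧ |varTerm γ y x D ψ| ≤ C * (1 + y ^ 2)⁻¹) :
    ∀ᵐ w ∂(densityLaw ν g), ∀ ψ : Ψ,
      |clippedLik hγ hDL hΨpos (w, ψ)| ≤ C * (1 + w.1 ^ 2)⁻¹ ∧
      |clippedVar hγ hDL hΨpos (w, ψ)| ≤ C * (1 + w.1 ^ 2)⁻¹ := by
  filter_upwards [ae_densityLaw_mem hD hxX] with w hw ψ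
  have h := hbound ψ.1 ψ.2 w.1 w.2.1 hw.1 w.2.2 hw.2
  simpa only [clippedLik, clippedVar, ContinuousMap.coe_mk, max_eq_left hw.2.1] using h

theorem abs_integral_le_mul {F : Measure (Obs p)} [IsFiniteMeasure F] {f : Obs p → ℝ} {e : ℝ}
    (hC : 0 ≤ C) (hf : ∀ᵐ w ∂F, |f w| ≤ C * (1 + w.1 ^ 2)⁻¹)
    (he : ∫ w : Obs p, (1 + w.1 ^ 2)⁻¹ ∂F ≤ e) : |∫ w, f w ∂F| ≤ C * e := by
  have hint : Integrable (fun w : Obs p => (1 + w.1 ^ 2)⁻¹) F := by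
    refine Integrable.of_bound (by fun_prop) 1 (Eventually.of_forall fun w => ?_)
    rw [Real.norm_of_nonneg (by positivity)]
    exact inv_le_one_of_one_le₀ (by nlinarith [sq_nonneg w.1])
  calc |∫ w, f w ∂F| ≤ ∫ w : Obs p, C * (1 + w.1 ^ 2)⁻¹ ∂F :=
        (Real.norm_eq_abs _).symm.trans_le (norm_integral_le_of_norm_le (hint.const_mul C) hf)
    _ = C * ∫ w : Obs p, (1 + w.1 ^ 2)⁻¹ ∂F := integral_const_mul _ _
    _ ≤ C * e := by gcongr

/-- A bounded continuous lower bound for `y²` that is nearly constant far from the origin. -/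
noncomputable def truncSq (p : ℕ) (M : ℝ) : C(Obs p × Unit, ℝ) where
  toFun q := max 0 (2 * M - 1 - M ^ 2 * (1 + q.1.1 ^ 2)⁻¹)
  continuous_toFun := by
    have h : ∀ q : Obs p × Unit, 1 + q.1.1 ^ 2 ≠ 0 := fun q => by positivity
    exact continuous_const.max (continuous_const.sub
      (continuous_const.mul (Continuous.inv₀ (by fun_prop) h)))

/-- From (1 + y² − M)² ≥ 0 divided by 1 + y². The bound is affine in (1 + y²)⁻¹, the one quantity
controlled under contamination. -/
theorem truncSq_le (M : ℝ) (w : Obs p) (u : Unit) : truncSq p M (w, u) ≤ w.1 ^ 2 := by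
  simp only [truncSq, ContinuousMap.coe_mk]
  refine max_le (sq_nonneg _) ?_
  have hy : 0 < 1 + w.1 ^ 2 := by positivity
  have h : (1 + w.1 ^ 2) + M ^ 2 * (1 + w.1 ^ 2)⁻¹ - 2 * M =
      (1 + w.1 ^ 2)⁻¹ * (1 + w.1 ^ 2 - M) ^ 2 := by field_simp; ring
  have : 0 ≤ (1 + w.1 ^ 2)⁻¹ * (1 + w.1 ^ 2 - M) ^ 2 := by positivity
  linarith

theorem abs_truncSq_le {M : ℝ} (hM : 0 ≤ M) (w : Obs p) (u : Unit) :
    |truncSq p M (w, u)| ≤ 2 * M := by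
  simp only [truncSq, ContinuousMap.coe_mk]
  rw [abs_of_nonneg (le_max_left _ _)]
  refine max_le (by positivity) ?_
  have : 0 ≤ M ^ 2 * (1 + w.1 ^ 2)⁻¹ := by positivity
  linarith

/-- The core contributes a nonnegative amount and is dropped; the contamination supplies the bound.
-/
theorem le_integral_truncSq [IsProbabilityMeasure ν] (hDL : 0 < DL)
    (hD : ∀ᵐ z ∂ν, z.2 ∈ Set.Icc DL DU)
    (hA : 0 < ψ₀.2) (hδ : IsProbDensity δ) (hω0 : 0 ≤ ω) (hω1 : ω ≤ 1) {M e : ℝ} (hM : 0 ≤ M)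
    (he : ∫ w : Obs p, (1 + w.1 ^ 2)⁻¹ ∂(contLaw ν δ) ≤ e) :
    ω * (2 * M - 1 - M ^ 2 * e) ≤ ∫ w, truncSq p M (w, ()) ∂(obsLaw ν ω ψ₀ δ) := by
  have hp₀ := isProbabilityMeasure_coreLaw hDL hD hA
  have hp₁ := isProbabilityMeasure_contLaw hDL hD hδ
  have hint : ∀ (F : Measure (Obs p)) [IsProbabilityMeasure F],
      Integrable (fun w => truncSq p M (w, ())) F := fun F _ =>
    Integrable.of_bound (Continuous.aestronglyMeasurable (by fun_prop)) (2 * M)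
      (Eventually.of_forall fun w => abs_truncSq_le hM w ())
  have hinv : Integrable (fun w : Obs p => (1 + w.1 ^ 2)⁻¹) (contLaw ν δ) := by
    refine Integrable.of_bound (by fun_prop) 1 (Eventually.of_forall fun w => ?_)
    rw [Real.norm_of_nonneg (by positivity)]
    exact inv_le_one_of_one_le₀ (by nlinarith [sq_nonneg w.1])
  rw [integral_obsLaw hDL hD hA hδ hω0 hω1 (hint _) (hint _)]
  have h0 : 0 ≤ (1 - ω) * ∫ w, truncSq p M (w, ()) ∂(coreLaw ν ψ₀) :=
    mul_nonneg (by linarith) (integral_nonneg fun w => le_max_left _ _)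
  have h1 : 2 * M - 1 - M ^ 2 * e ≤ ∫ w, truncSq p M (w, ()) ∂(contLaw ν δ) := by
    calc 2 * M - 1 - M ^ 2 * e
        ≤ 2 * M - 1 - M ^ 2 * ∫ w : Obs p, (1 + w.1 ^ 2)⁻¹ ∂(contLaw ν δ) := by gcongr
      _ = ∫ w : Obs p, (2 * M - 1 - M ^ 2 * (1 + w.1 ^ 2)⁻¹) ∂(contLaw ν δ) := by
          rw [integral_sub (integrable_const _) (hinv.const_mul _), integral_const_mul]
          simp
      _ ≤ _ := integral_mono ((integrable_const _).sub (hinv.const_mul _)) (hint _)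
          fun w => le_max_right _ _
  have h2 := mul_le_mul_of_nonneg_left h1 hω0
  linarith

/-- The function `D² / (A + D)` as a continuous function; `D` is cut off below at `DL`. -/
noncomputable def clippedShrinkage (p : ℕ) {A DL : ℝ} (hA : 0 < A) (hDL : 0 < DL) :
    C(Obs p × Unit, ℝ) where
  toFun q := max q.1.2.2 DL ^ 2 / (A + max q.1.2.2 DL)
  continuous_toFun := by
    have h : ∀ q : Obs p × Unit, A + max q.1.2.2 DL ≠ 0 := fun q =>
      (add_pos hA (hDL.trans_le (le_max_right _ _))).ne'
    exact Continuous.div (by fun_prop) (by fun_prop) h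

theorem abs_clippedShrinkage_le {A : ℝ} (hA : 0 < A) (hDL : 0 < DL) {w : Obs p}
    (hw : w.2.2 ∈ Set.Icc DL DU) (u : Unit) : |clippedShrinkage p hA hDL (w, u)| ≤ DU := by
  have h0 : 0 < w.2.2 := hDL.trans_le hw.1
  simp only [clippedShrinkage, ContinuousMap.coe_mk, max_eq_left hw.1]
  rw [abs_of_nonneg (by positivity), div_le_iff₀ (by positivity)]
  nlinarith [hw.2, mul_pos h0 hA, mul_le_mul_of_nonneg_right hw.2 (add_pos hA h0).le]

theorem integral_clippedShrinkage {F : Measure (Obs p)} (hA : 0 < ψ₀.2) (hDL : 0 < DL)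
    (hD : ∀ᵐ z ∂ν, z.2 ∈ Set.Icc DL DU) (hF : F.map Prod.snd = ν) :
    ∫ w, clippedShrinkage p hA hDL (w, ()) ∂F = ∫ z, z.2 ^ 2 / (ψ₀.2 + z.2) ∂ν := by
  calc ∫ w, clippedShrinkage p hA hDL (w, ()) ∂F
      = ∫ z : Cov p × ℝ, max z.2 DL ^ 2 / (ψ₀.2 + max z.2 DL) ∂(F.map Prod.snd) := by
        rw [integral_map (by fun_prop) (Measurable.aestronglyMeasurable (by fun_prop))]
        rfl
    _ = _ := by
        rw [hF]
        refine integral_congr_ae ?_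
        filter_upwards [hD] with z hz
        rw [max_eq_left hz.1]

theorem map_snd_densityLaw [SFinite ν] {g : Cov p × ℝ → ℝ → ℝ≥0∞}
    (hg : Measurable fun q : (Cov p × ℝ) × ℝ => g q.1 q.2) (h1 : ∀ᵐ z ∂ν, ∫⁻ y, g z y = 1) :
    (densityLaw ν g).map Prod.snd = ν := by
  refine Measure.ext_of_lintegral _ fun f hf => ?_
  rw [lintegral_map hf measurable_snd, lintegral_densityLaw hg (by fun_prop)]
  refine lintegral_congr_ae ?_
  filter_upwards [h1] with z hz
  have hg' : Measurable fun y => g z y := hg.comp measurable_prodMk_left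
  rw [lintegral_mul_const _ hg', hz, one_mul]

/-- Contamination alters only θ and y. The averages of D²/(A⋆ + D) therefore have the same limit as
in the Gaussian model. -/
theorem map_snd_obsLaw [IsProbabilityMeasure ν] (hDL : 0 < DL)
    (hD : ∀ᵐ z ∂ν, z.2 ∈ Set.Icc DL DU)
    (hA : 0 < ψ₀.2) (hδ : IsProbDensity δ) (hω0 : 0 ≤ ω) (hω1 : ω ≤ 1) :
    (obsLaw ν ω ψ₀ δ).map Prod.snd = ν := by
  rw [obsLaw_eq hDL hD hA hδ hω0 hω1, Measure.map_add _ _ measurable_snd, Measure.map_smul,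
    Measure.map_smul, coreLaw, contLaw, map_snd_densityLaw measurable_coreDensity.ennreal_ofReal,
    map_snd_densityLaw (measurable_margDensity hδ.measurable), ← add_smul,
    ← ENNReal.ofReal_add (by linarith) hω0]
  · simp
  · filter_upwards [hD] with z hz
    exact lintegral_margDensity hδ (by linarith [hz.1])
  · filter_upwards [hD] with z hz
    exact lintegral_phi (by linarith [hz.1]) _

end asymptotics


/-- In large samples from the contaminated model, the average variance term at the `γ`-estimate
is at most its expectation at the true parameter, up to a small error. -/
theorem eventually_average_varTerm_le {p : ℕ} {ν : Measure (Cov p × ℝ)} [IsProbabilityMeasure ν]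
    {X : Set (Cov p)} {DL DU ω γ C η κ e : ℝ} {Ψ : Set (Param p)} {ψ₀ : Ψ} {δ : ℝ → ℝ}
    [CompactSpace Ψ] (hγ : 0 < γ) (hDL : 0 < DL) (hΨpos : ∀ ψ ∈ Ψ, 0 < ψ.2)
    (hD : ∀ᵐ z ∂ν, z.2 ∈ Set.Icc DL DU) (hxX : ∀ᵐ z ∂ν, z.1 ∈ X) (hC : 0 < C)
    (hbound : ∀ ψ ∈ Ψ, ∀ (y : ℝ), ∀ x ∈ X, ∀ D ∈ Set.Icc DL DU,
      |gammaLik γ y x D ψ| ≤ C * (1 + y ^ 2)⁻¹ ∧ |varTerm γ y x D ψ| ≤ C * (1 + y ^ 2)⁻¹)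
    (hω : ω ∈ Set.Ioo (0 : ℝ) (1 / 2)) (hη : 0 < η) (hκ : 0 < κ)
    (hgap : ∀ ψ : Ψ, ∫ w, clippedLik hγ hDL hΨpos (w, ψ₀) ∂(coreLaw ν ψ₀.1) - η ≤
        ∫ w, clippedLik hγ hDL hΨpos (w, ψ) ∂(coreLaw ν ψ₀.1) →
      ∫ w, clippedVar hγ hDL hΨpos (w, ψ) ∂(coreLaw ν ψ₀.1) <
        ∫ w, clippedVar hγ hDL hΨpos (w, ψ₀) ∂(coreLaw ν ψ₀.1) + κ)
    (hδ : IsProbDensity δ) (he : ∫ w : Obs p, (1 + w.1 ^ 2)⁻¹ ∂(contLaw ν δ) ≤ e)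
    (heη : C * e ≤ η / 4) (heκ : C * e ≤ κ)
    {Ω : Type*} [MeasurableSpace Ω] {P : Measure Ω} {x : ℕ → Ω → Cov p} {D y : ℕ → Ω → ℝ}
    (hind : iIndepFun (fun i s => (y i s, x i s, D i s)) P)
    (hlaw : ∀ i, HasLaw (fun s => (y i s, x i s, D i s)) (obsLaw ν ω ψ₀.1 δ) P) :
    ∀ᵐ s ∂P, (∀ i, D i s ∈ Set.Icc DL DU) → ∀ᶠ m : ℕ in atTop, ∀ ψ,
      IsEstimate Ψ γ m (fun i => y i s) (fun i => x i s) (fun i => D i s) ψ →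
      (m : ℝ)⁻¹ * ∑ i ∈ Finset.range m, varTerm γ (y i s) (x i s) (D i s) ψ ≤
        (1 - ω) * ∫ w, clippedVar hγ hDL hΨpos (w, ψ₀) ∂(coreLaw ν ψ₀.1) + 3 * κ := by
  obtain ⟨hω0, hω2⟩ := hω
  have hω1 : ω ≤ 1 := by linarith
  have hA : 0 < ψ₀.1.2 := hΨpos _ ψ₀.2
  have hp := isProbabilityMeasure_obsLaw hDL hD hA hδ hω0.le hω1
  have hp₀ := isProbabilityMeasure_coreLaw hDL hD hA
  have hp₁ := isProbabilityMeasure_contLaw hDL hD hδ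
  have hb₀ : ∀ᵐ w ∂(coreLaw ν ψ₀.1), _ := ae_clipped_bound hγ hDL hΨpos hD hxX hbound
  have hb₁ : ∀ᵐ w ∂(contLaw ν δ), _ := ae_clipped_bound hγ hDL hΨpos hD hxX hbound
  have hb := ae_obsLaw hDL hD hA hδ hω0.le hω1 hb₀ hb₁
  have hCle : ∀ w : Obs p, C * (1 + w.1 ^ 2)⁻¹ ≤ C := fun w =>
    mul_le_of_le_one_right hC.le (inv_le_one_of_one_le₀ (by nlinarith [sq_nonneg w.1]))
  have hint : ∀ (F : Measure (Obs p)) [IsProbabilityMeasure F] (f : C(Obs p × Ψ, ℝ)) (ψ : Ψ),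
      (∀ᵐ w ∂F, |f (w, ψ)| ≤ C * (1 + w.1 ^ 2)⁻¹) → Integrable (fun w => f (w, ψ)) F :=
    fun F _ f ψ h => Integrable.of_bound (Continuous.aestronglyMeasurable (by fun_prop)) C
      (h.mono fun w hw => hw.trans (hCle w))
  have hmix : ∀ (f : C(Obs p × Ψ, ℝ)) (ψ : Ψ),
      (∀ᵐ w ∂(coreLaw ν ψ₀.1), |f (w, ψ)| ≤ C * (1 + w.1 ^ 2)⁻¹) →
      (∀ᵐ w ∂(contLaw ν δ), |f (w, ψ)| ≤ C * (1 + w.1 ^ 2)⁻¹) →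
      |∫ w, f (w, ψ) ∂(obsLaw ν ω ψ₀.1 δ) - (1 - ω) * ∫ w, f (w, ψ) ∂(coreLaw ν ψ₀.1)| ≤
        ω * (C * e) := by
    intro f ψ h₀ h₁
    rw [integral_obsLaw hDL hD hA hδ hω0.le hω1 (hint _ f ψ h₀) (hint _ f ψ h₁),
      add_sub_cancel_left, abs_mul, abs_of_pos hω0]
    exact mul_le_mul_of_nonneg_left (abs_integral_le_mul hC.le h₁ he) hω0.le
  filter_upwards [uniform_strong_law hind hlaw (clippedLik hγ hDL hΨpos) hC.le
      (hb.mono fun w hw ψ => (hw ψ).1.trans (hCle w)),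
    uniform_strong_law hind hlaw (clippedVar hγ hDL hΨpos) hC.le
      (hb.mono fun w hw ψ => (hw ψ).2.trans (hCle w))] with s hs₁ hs₂ hDs
  -- Two sampling errors η/8 and two contamination errors ωCe ≤ η/8 add up to η/2 in the comparison
  -- of likelihoods at ψ₀ and at the estimate.
  filter_upwards [hs₁ (η / 8) (by positivity), hs₂ κ hκ] with m hm₁ hm₂ ψ hψ
  set ψ' : Ψ := ⟨ψ, hψ.1⟩
  have hlik : ∀ ψ : Ψ, ∑ i ∈ Finset.range m,
      clippedLik hγ hDL hΨpos ((y i s, x i s, D i s), ψ) =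
      ∑ i ∈ Finset.range m, gammaLik γ (y i s) (x i s) (D i s) ψ.1 := fun ψ =>
    Finset.sum_congr rfl fun i _ => by
      simp only [clippedLik, ContinuousMap.coe_mk, max_eq_left (hDs i).1]
  have hvar : ∑ i ∈ Finset.range m,
      clippedVar hγ hDL hΨpos ((y i s, x i s, D i s), ψ') =
      ∑ i ∈ Finset.range m, varTerm γ (y i s) (x i s) (D i s) ψ :=
    Finset.sum_congr rfl fun i _ => by
      simp only [clippedVar, ContinuousMap.coe_mk, max_eq_left (hDs i).1, ψ']
  have hmax : ∑ i ∈ Finset.range m, gammaLik γ (y i s) (x i s) (D i s) ψ₀.1 ≤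
      ∑ i ∈ Finset.range m, gammaLik γ (y i s) (x i s) (D i s) ψ := hψ.2 ψ₀.2
  have hmax' := mul_le_mul_of_nonneg_left hmax (show (0 : ℝ) ≤ (m : ℝ)⁻¹ by positivity)
  have a1 := (abs_le.1 (hm₁ ψ₀)).1
  have a2 := (abs_le.1 (hm₁ ψ')).2
  have a3 := (abs_le.1 (hm₂ ψ')).2
  rw [hlik] at a1 a2
  rw [hvar] at a3
  have b1 := (abs_le.1 (hmix (clippedLik hγ hDL hΨpos) ψ₀ (hb₀.mono fun w hw => (hw ψ₀).1)
    (hb₁.mono fun w hw => (hw ψ₀).1))).1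
  have b2 := (abs_le.1 (hmix (clippedLik hγ hDL hΨpos) ψ' (hb₀.mono fun w hw => (hw ψ').1)
    (hb₁.mono fun w hw => (hw ψ').1))).2
  have b3 := (abs_le.1 (hmix (clippedVar hγ hDL hΨpos) ψ' (hb₀.mono fun w hw => (hw ψ').2)
    (hb₁.mono fun w hw => (hw ψ').2))).2
  have c1 : ω * (C * e) ≤ 1 / 2 * (η / 4) :=
    (mul_le_mul_of_nonneg_left heη hω0.le).trans
      (mul_le_mul_of_nonneg_right hω2.le (by positivity))
  have c2 : ω * (C * e) ≤ κ :=
    (mul_le_mul_of_nonneg_left heκ hω0.le).trans (mul_le_of_le_one_left hκ.le hω1)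
  set H₀ := ∫ w, clippedLik hγ hDL hΨpos (w, ψ₀) ∂(coreLaw ν ψ₀.1)
  set H₁ := ∫ w, clippedLik hγ hDL hΨpos (w, ψ') ∂(coreLaw ν ψ₀.1)
  -- Dividing (1 − ω)(H₀ − H₁) ≤ η/2 by 1 − ω > 1/2 recovers η; this is where ω < 1/2 enters.
  have hnear : H₀ - η ≤ H₁ := by
    have h1 : (1 - ω) * (H₀ - H₁) ≤ η / 2 := by linarith
    by_contra! hlt
    have h2 : (1 - ω) * η ≤ (1 - ω) * (H₀ - H₁) :=
      mul_le_mul_of_nonneg_left (by linarith) (by linarith)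
    have h3 : ω * η < 1 / 2 * η := mul_lt_mul_of_pos_right hω2 hη
    linarith
  have hV := hgap ψ' hnear
  have hV' := mul_le_mul_of_nonneg_left hV.le (show 0 ≤ 1 - ω by linarith)
  have h4 : 0 ≤ ω * κ := by positivity
  -- The three κ are the sampling error, the contamination error, and the gap at a near-maximizer
  -- weighted by 1 − ω.
  linarith

end RobustFayHerriot

/-! ### The selection theorem -/

open RobustFayHerriot

theorem theorem3 {p : ℕ} [NeZero p]
    -- the law of `(x_i, D_i)`, the covariate range, the parameter space and the candidate set
    (ν : Measure (RobustFayHerriot.Cov p × ℝ)) [IsProbabilityMeasure ν]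
    (X : Set (RobustFayHerriot.Cov p)) (DL DU : ℝ)
    (Ψ : Set (RobustFayHerriot.Param p)) (ψstar : RobustFayHerriot.Param p)
    (Γ : Finset ℝ) (ω γstar : ℝ)
    -- bounded sampling variances
    (hDL : 0 < DL) (hD : ∀ᵐ z ∂ν, z.2 ∈ Set.Icc DL DU)
    -- bounded covariates with positive-definite second moment matrix
    (hX : Bornology.IsBounded X) (hxX : ∀ᵐ z ∂ν, z.1 ∈ X)
    (hxx : (Matrix.of fun j k : Fin p => ∫ z, z.1 j * z.1 k ∂ν).PosDef)
    -- compact parameter space containing the true parameter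
    (hΨ : IsCompact Ψ) (hΨpos : ∀ ψ ∈ Ψ, 0 < ψ.2) (hψstar : ψstar ∈ Ψ)
    -- the first covariate is the constant term
    (hconst : ∀ᵐ z ∂ν, z.1 0 = 1)
    (hns : ∀ a : ℝ, 0 < a →
      (Matrix.of fun j k : Fin p => ∫ z, z.1 j * z.1 k / (a + z.2) ∂ν).det ≠ 0)
    -- the candidate set satisfies `{0, 1} ⊆ Γ ⊆ [0, 1]`
    (hΓ0 : 0 ∈ Γ) (hΓ1 : 1 ∈ Γ) (hΓ : ∀ γ ∈ Γ, γ ∈ Set.Icc (0 : ℝ) 1)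
    (hω : ω ∈ Set.Ioo (0 : ℝ) (1 / 2))
    (hγstar : γstar ∈ Γ) (hγstar0 : γstar ≠ 0)
    (hQ : RobustFayHerriot.Q ν ψstar 0 ψstar >
      (1 - ω) * RobustFayHerriot.Q ν ψstar γstar ψstar) :
    ∃ ρ₀ : ℝ, 0 < ρ₀ ∧
      ∀ δ : ℝ → ℝ, RobustFayHerriot.IsProbDensity δ →
        -- finite mean and variance of the contamination distribution
        Integrable (fun θ => θ * δ θ) →
        Integrable (fun θ => (θ - RobustFayHerriot.densityMean δ) ^ 2 * δ θ) →
        -- `E[(xᵀβ⋆ - μ_δ)² | D] ≥ A⋆ + D_U` almost surely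
        (∀ᵐ z ∂ν, ψstar.2 + DU ≤
          (ν[fun z => (inner ℝ z.1 ψstar.1 - RobustFayHerriot.densityMean δ) ^ 2 |
            MeasurableSpace.comap Prod.snd inferInstance]) z) →
        -- regularity conditions (a)-(e)
        (∃ ψdag, RobustFayHerriot.ScoreRegularity
          (RobustFayHerriot.obsLaw ν ω ψstar δ) X DL DU Ψ γstar ψdag) →
        -- `ρ` is sufficiently small
        RobustFayHerriot.rho X DL DU ψstar γstar δ ≤ ENNReal.ofReal ρ₀ →
        ∀ (Ω : Type*) [MeasurableSpace Ω] (P : Measure Ω) [IsProbabilityMeasure P]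
          (x : ℕ → Ω → RobustFayHerriot.Cov p) (D θ y : ℕ → Ω → ℝ)
          (ψhat : ℕ → ℝ → Ω → RobustFayHerriot.Param p) (γop : ℕ → Ω → ℝ),
          -- i.i.d. observations from the contaminated two-stage model
          iIndepFun (fun i s => (y i s, x i s, D i s)) P →
          (∀ i, HasLaw (fun s => ((x i s, D i s), (θ i s, y i s)))
            (RobustFayHerriot.jointLaw ν ω ψstar δ) P) →
          -- the estimates of `ψ` and the selected tuning parameter
          (∀ m, ∀ᵐ s ∂P, ∀ γ ∈ Γ, RobustFayHerriot.IsEstimate Ψ γ m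
            (fun i => y i s) (fun i => x i s) (fun i => D i s) (ψhat m γ s)) →
          (∀ m, ∀ᵐ s ∂P, RobustFayHerriot.IsSelected Γ m
            (fun i => y i s) (fun i => x i s) (fun i => D i s) (fun γ => ψhat m γ s)
            (γop m s)) →
          Tendsto (fun m => P {s | 0 < γop m s}) atTop (𝓝 1) := by
  have hγ0 : 0 < γstar := lt_of_le_of_ne (hΓ _ hγstar).1 hγstar0.symm
  have hA : 0 < ψstar.2 := hΨpos _ hψstar
  obtain ⟨hω0, hω2⟩ := hω
  have hω1 : ω ≤ 1 := by linarith
  obtain ⟨z₁, hz₁⟩ := hD.exists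
  have hDU : 0 < DU := hDL.trans_le (hz₁.1.trans hz₁.2)
  have : CompactSpace Ψ := isCompact_iff_compactSpace.1 hΨ
  obtain ⟨M₀, hM₀⟩ := hX.exists_norm_le
  obtain ⟨R, hR⟩ := hΨ.isBounded.exists_norm_le
  have hB : ∀ x ∈ X, ∀ ψ ∈ Ψ, |inner ℝ x ψ.1| ≤ M₀ * R := fun x hx ψ hψ =>
    (abs_real_inner_le_norm _ _).trans (mul_le_mul (hM₀ x hx)
      ((norm_fst_le ψ).trans (hR ψ hψ)) (norm_nonneg _) ((norm_nonneg _).trans (hM₀ x hx)))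
  obtain ⟨C, hC, hCbound⟩ := exists_bound (p := p) (γ := γstar) (DL := DL) (DU := DU) (Al := 0)
    (Au := R) (B := M₀ * R) hγ0 hDL le_rfl
  have hbound : ∀ ψ ∈ Ψ, ∀ (y : ℝ), ∀ x ∈ X, ∀ D ∈ Set.Icc DL DU,
      |gammaLik γstar y x D ψ| ≤ C * (1 + y ^ 2)⁻¹ ∧
      |varTerm γstar y x D ψ| ≤ C * (1 + y ^ 2)⁻¹ := fun ψ hψ y x hx D hD =>
    hCbound ψ y x D hD ⟨(hΨpos ψ hψ).le, (le_abs_self _).trans ((norm_snd_le ψ).trans (hR ψ hψ))⟩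
      (hB x hx ψ hψ)
  set ψ₀ : Ψ := ⟨ψstar, hψstar⟩
  have hp₀ := isProbabilityMeasure_coreLaw hDL hD hA
  have hb₀ : ∀ᵐ w ∂(coreLaw ν ψstar), _ := ae_clipped_bound hγ0 hDL hΨpos hD hxX hbound
  have hCle : ∀ w : Obs p, C * (1 + w.1 ^ 2)⁻¹ ≤ C := fun w =>
    mul_le_of_le_one_right hC.le (inv_le_one_of_one_le₀ (by nlinarith [sq_nonneg w.1]))
  have hbL : ∀ᵐ w ∂(coreLaw ν ψstar), ∀ ψ, |clippedLik hγ0 hDL hΨpos (w, ψ)| ≤ C :=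
    hb₀.mono fun w hw ψ => (hw ψ).1.trans (hCle w)
  have hbV : ∀ᵐ w ∂(coreLaw ν ψstar), ∀ ψ, |clippedVar hγ0 hDL hΨpos (w, ψ)| ≤ C :=
    hb₀.mono fun w hw ψ => (hw ψ).2.trans (hCle w)
  have hQ₁ : Q ν ψstar γstar ψstar =
      ∫ w, clippedVar hγ0 hDL hΨpos (w, ψ₀) ∂(coreLaw ν ψstar) := by
    have hc : Continuous fun w : Obs p => clippedVar hγ0 hDL hΨpos (w, ψ₀) := by fun_prop
    rw [Q_eq hA hDL hD]
    exact (integral_coreLaw (ν := ν) hD (f := fun y x D => varTerm γstar y x D ψstar)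
      hc.measurable (Integrable.of_bound hc.aestronglyMeasurable C
        (hbV.mono fun w hw => hw ψ₀))).2.symm
  set κ := Q ν ψstar 0 ψstar - (1 - ω) * Q ν ψstar γstar ψstar with hκdef
  have hκ : 0 < κ := by linarith
  -- Error budget in units of κ/8: three for γ⋆, and two for γ = 0 (the scale estimate and the
  -- average of D²/(A⋆ + D)). Five eighths is less than one.
  have hκ' : 0 < κ / 8 := by linarith
  obtain ⟨η, hη, hgap⟩ := exists_gap
    (continuous_integral_of_bound (clippedLik hγ0 hDL hΨpos) hC.le hbL)
    (continuous_integral_of_bound (clippedVar hγ0 hDL hΨpos) hC.le hbV) (k₀ := ψ₀)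
    (fun ψ hψ => integral_gammaLik_lt hγ0 hDL hΨpos hD hX hxX hxx ψ₀ ψ hψ hbL) hκ'
  obtain ⟨c, Cg, hc, hlik0⟩ := exists_gammaLik_zero_gap (p := p) (DL := DL) (DU := DU)
    (B := M₀ * R) (ψ₀ := ψstar) hDL hDU hA hκ'
  -- Chosen so that ω(2M − 2) = |Cg/c| + 2: after a sampling error of 1, the mean of y² still
  -- exceeds Cg/c.
  set M := (|Cg / c| + 2) / (2 * ω) + 1 with hM
  have hM0 : 0 < M := by positivity
  -- The three bounds serve, in order, the lower bound on y², the variance term and the objective.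
  -- All constants so far are independent of δ, hence so is ρ₀.
  set e := min (1 / M ^ 2) (min (κ / 8 / C) (η / 4 / C)) with he
  have he0 : 0 < e := by positivity
  have he1 : M ^ 2 * e ≤ 1 := by
    have : e ≤ 1 / M ^ 2 := min_le_left _ _
    rwa [le_div_iff₀ (by positivity), mul_comm] at this
  have he2 : C * e ≤ κ / 8 := by
    have : e ≤ κ / 8 / C := (min_le_right _ _).trans (min_le_left _ _)
    rwa [le_div_iff₀ hC, mul_comm] at this
  have he3 : C * e ≤ η / 4 := by
    have : e ≤ η / 4 / C := (min_le_right _ _).trans (min_le_right _ _)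
    rwa [le_div_iff₀ hC, mul_comm] at this
  obtain ⟨ρ₀, hρ₀, hρ⟩ := exists_rho_bound hDL hX hD hxX hA hγ0.le he0
  refine ⟨ρ₀, hρ₀, ?_⟩
  intro δ hδ _ _ _ _ hδρ Ω _ P _ x D θ y ψhat γop hind hjoint hest hsel
  have hcont := hρ δ hδ hδρ
  have hlaw := fun i => hasLaw_obs (hjoint i)
  have hp := isProbabilityMeasure_obsLaw hDL hD hA hδ hω0.le hω1
  have hmem : ∀ᵐ w ∂(obsLaw ν ω ψstar δ), w.2.1 ∈ X ∧ w.2.2 ∈ Set.Icc DL DU :=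
    ae_obsLaw hDL hD hA hδ hω0.le hω1 (ae_densityLaw_mem hD hxX) (ae_densityLaw_mem hD hxX)
  have hmems : ∀ᵐ s ∂P, ∀ i, x i s ∈ X ∧ D i s ∈ Set.Icc DL DU := by
    refine ae_all_iff.2 fun i => ?_
    have h := hmem
    rw [← (hlaw i).map_eq] at h
    exact ae_of_ae_map (hlaw i).aemeasurable h
  have hvar := eventually_average_varTerm_le (ψ₀ := ψ₀) hγ0 hDL hΨpos hD hxX hC hbound
    ⟨hω0, hω2⟩ hη hκ' hgap hδ hcont he3 he2 hind hlaw
  have hsq := uniform_strong_law hind hlaw (truncSq p M) (C := 2 * M) (by positivity)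
    (Eventually.of_forall fun w u => abs_truncSq_le hM0.le w u)
  have hshr := uniform_strong_law hind hlaw (clippedShrinkage p hA hDL) (C := DU) hDU.le
    (hmem.mono fun w hw u => abs_clippedShrinkage_le hA hDL hw.2 u)
  have hshrInt :=
    integral_clippedShrinkage hA hDL hD (map_snd_obsLaw hDL hD hA hδ hω0.le hω1)
  have hEsq := le_integral_truncSq hDL hD hA hδ hω0.le hω1 hM0.le hcont
  -- From here on the argument is deterministic: a sample point outside a null set is fixed and m is
  -- large.
  refine tendsto_measure_setOf_of_ae_eventually ?_
  filter_upwards [hmems, hvar, hsq, hshr, ae_all_iff.2 hest, ae_all_iff.2 hsel]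
    with s hs hvars hsqs hshrs hests hsels
  filter_upwards [hvars fun i => (hs i).2, hsqs 1 one_pos, hshrs (κ / 8) hκ',
    eventually_gt_atTop 0] with m h1 h2 h3 hm
  have hm' : (0 : ℝ) < m := by exact_mod_cast hm
  have hscale : ψstar.2 - κ / 8 ≤ (ψhat m 0 s).2 := by
    refine le_estimate_snd hΨpos hψstar hlik0 (fun i => (hs i).2)
      (fun i ψ hψ => hB _ (hs i).1 ψ hψ) ?_ (hests m 0 hΓ0)
    have hsum : ∑ i ∈ Finset.range m, truncSq p M ((y i s, x i s, D i s), ()) ≤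
        ∑ i ∈ Finset.range m, y i s ^ 2 :=
      Finset.sum_le_sum fun i _ => truncSq_le M (y i s, x i s, D i s) ()
    have h4 := (abs_le.1 (h2 ())).1
    have h5 : ω * (2 * M - 2) ≤ ω * (2 * M - 1 - M ^ 2 * e) :=
      mul_le_mul_of_nonneg_left (by linarith) hω0.le
    have h6 : ω * (2 * M - 2) = |Cg / c| + 2 := by rw [hM]; field_simp; ring
    have h7 : Cg / c < (m : ℝ)⁻¹ * ∑ i ∈ Finset.range m, y i s ^ 2 := by
      have := mul_le_mul_of_nonneg_left hsum (show (0 : ℝ) ≤ (m : ℝ)⁻¹ by positivity)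
      linarith [le_abs_self (Cg / c)]
    rw [lt_inv_mul_iff₀ hm', mul_div_assoc', div_lt_iff₀ hc] at h7
    linarith
  have hne : γop m s ≠ 0 := by
    refine selected_ne_zero (q := ∫ z, z.2 ^ 2 / (ψstar.2 + z.2) ∂ν + κ / 8) hm hA hΨpos hDL
      hκ'.le hγstar (fun i => (hs i).2) (hests m 0 hΓ0).1 hscale ?_ (h1 _ (hests m γstar hγstar))
      ?_ (hsels m)
    · have h4 := (abs_le.1 (h3 ())).2
      have h5 : ∑ i ∈ Finset.range m, clippedShrinkage p hA hDL ((y i s, x i s, D i s), ()) =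
          ∑ i ∈ Finset.range m, D i s ^ 2 / (ψstar.2 + D i s) :=
        Finset.sum_congr rfl fun i _ => by
          simp only [clippedShrinkage, ContinuousMap.coe_mk, max_eq_left (hs i).2.1]
      rw [h5] at h4
      linarith
    -- The required inequality is (1 − ω) Q(γ⋆; ψ⋆) + 3κ/8 < Q(0; ψ⋆) − 2κ/8, true by the definition
    -- of κ.
    · have h4 := Q_zero hA hDL hD
      rw [hQ₁] at hκdef
      linarith
  exact lt_of_le_of_ne (hΓ _ (hsels m).1).1 hne.symm
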